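/- **Model.** Let $V$ be a set of at most $n$ potential nodes, each with a unique identifier (an arbitrary natural number). A dynamic graph is a sequence $G_0,G_1,\dots$ of simple graphs $G_r=(V_r,E_r)$ with $\emptyset=V_0\subseteq V_1\subseteq V_2\subseteq\dots\subseteq V$; $V_r$ is the set of nodes that are awake in round $r$. In round $r$ the graph $G_r$ is fixed by the adversary, then every node of $V_r$ draws fresh independent random bits, broadcasts a message to its (a priori unknown) neighbors in $G_r$, receives the messages of its neighbors, updates its state and returns an output in $\{1,0,\bot\}$ ($1$: in the set, $0$: not in the set, $\bot$: no output). All nodes run the same algorithm and know $n$, but not the round number. The adversary is $2$-oblivious: $G_r$ may depend arbitrarily on the random bits of all rounds up to $r-2$, but not on those of rounds $r-1$ and $r$. For $T\ge 1$ and $r_0=\max\{0,r-T+1\}$ let $V_r^{T\cap}=\bigcap_{s=r_0}^{r}V_s$; the $T$-intersection graph $G_r^{T\cap}$ has node set $V_r^{T\cap}$ and edge set $\bigcap_{s=r_0}^{r}E_s$; the $T$-union graph $G_r^{T\cup}$ has node set $V_r^{T\cap}$ and, as edges, the pairs in $\bigcup_{s=r_0}^{r}E_s$ with both endpoints in $V_r^{T\cap}$.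 The output of round $r$ is a *$T$-dynamic solution for MIS* if all nodes of $V_r^{T\cap}$ have output $0$ or $1$, the nodes with output $1$ form an independent set of $G_r^{T\cap}$, and every node of $G_r^{T\cup}$ has output $1$ or has a neighbor in $G_r^{T\cup}$ with output $1$. For $v\in V_r$, the $2$-neighborhood of $v$ is *static on $[r,r_2]$* if the graphs $G_l[N_2(v)]$, induced by the nodes at distance at most $2$ from $v$ in $G_l$, are the same for all $l\in[r,r_2]$. **Corollary.** For every constant $c>1$ and every polynomial $L$ there are $T=T(n)\ge 1$ with $T=O(\log n)$ and a randomized distributed algorithm such that, for every $n\ge 1$, against every $2$-oblivious adversary, with probability at least $1-1/n^{c}$ the following holds in an execution of length $L(n)$: 1. in every round $r\le L(n)$ the output is a $T$-dynamic solution for MIS; 2. for every $r$, every $r_2\le L(n)$ and every node $v\in V_r$ whose $2$-neighborhood is static on $[r,r_2]$, the output of $v$ is the same in all rounds of $[r+2T,r_2]$. -/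

import Mathlib

open MeasureTheory Filter Asymptotics

namespace DynNet

/-! ### Graphs, dynamic graphs, intersection and union graphs -/

/-- A simple undirected graph whose vertex set is a subset of the set `V` of potential nodes. -/
abbrev Net (V : Type) := (⊤ : SimpleGraph V).Subgraph

/-- The rounds `max 0 (r - T + 1), …, r` (the truncated subtraction realises the maximum). -/
def window (T r : ℕ) : Set ℕ := Set.Icc (r + 1 - T) r

/-- The `T`-intersection graph in round `r`. -/
def interGraph {V : Type} (G : ℕ → Net V) (T r : ℕ) : Net V :=
  ⨅ s ∈ window T r, G s

/-- The `T`-union graph in round `r`: its vertices are those of the `T`-intersection graph, its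
edges are the edges between them that were present at least once in the last `T` rounds. -/
def unionGraph {V : Type} (G : ℕ → Net V) (T r : ℕ) : Net V :=
  (⨆ s ∈ window T r, G s).induce (interGraph G T r).verts

/-- The `a`-neighborhood of `v` in `G`: all nodes of `G` at distance at most `a` from `v`. -/
def nbhd {V : Type} (G : Net V) (a : ℕ) (v : V) : Set V :=
  {u | u ∈ G.verts ∧ G.spanningCoe.edist v u ≤ (a : ℕ∞)}

/-- `v` is awake from round `r` on and the graph induced by its `a`-neighborhood is the same in all
rounds of `[r, r₂]`. -/
def StaticOn {V : Type} (G : ℕ → Net V) (a : ℕ) (v : V) (r r₂ : ℕ) : Prop :=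
  v ∈ (G r).verts ∧ ∀ l ∈ Set.Icc r r₂, ∀ l' ∈ Set.Icc r r₂,
    (G l).induce (nbhd (G l) a v) = (G l').induce (nbhd (G l') a v)

/-! ### Distributed graph problems

An output vector assigns to every node `some true` (the node is in the set), `some false` (it is
not) or `none` (the node has no output, `⊥`). -/

/-- Independent set (a packing problem): all nodes have an output, and no two adjacent nodes
are in the set. -/
def IsIndepSolution {V : Type} (G : Net V) (y : V → Option Bool) : Prop :=
  (∀ v ∈ G.verts, y v ≠ none) ∧
    ∀ u v, G.Adj u v → ¬ (y u = some true ∧ y v = some true)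

/-- Dominating set (a covering problem): all nodes have an output, and every node is in the set
or adjacent to a node in the set. -/
def IsDomSolution {V : Type} (G : Net V) (y : V → Option Bool) : Prop :=
  (∀ v ∈ G.verts, y v ≠ none) ∧
    ∀ v ∈ G.verts, y v = some true ∨ ∃ u, G.Adj v u ∧ y u = some true

/-- `y` is a `T`-dynamic solution for MIS in round `r`: it solves the independent set problem on
the `T`-intersection graph and the dominating set problem on the `T`-union graph. -/
def IsDynamicMIS {V : Type} (G : ℕ → Net V) (T r : ℕ) (y : V → Option Bool) : Prop :=
  IsIndepSolution (interGraph G T r) y ∧ IsDomSolution (unionGraph G T r) y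

/-! ### Randomized distributed algorithms -/

/-- A randomized synchronous local broadcast algorithm with MIS-type outputs. All nodes run the same
code (which may depend on the upper bound on the number of nodes); apart from that, a node initially
knows only its own identifier, a natural number. In every round a node draws `bits` fresh random bits, broadcasts one message (before knowing its neighbors),
receives the multiset of the messages of its current neighbors, and updates its state. -/
structure Alg where
  /-- number of random bits drawn per node and round -/
  bits : ℕ
  /-- local states -/
  State : Type
  /-- messages -/
  Msg : Type
  /-- state of a node, given its identifier, when it wakes up -/
  init : ℕ → State
  /-- message broadcast in a round, from the state and the fresh random bits -/
  send : State → (Fin bits → Bool) → Msg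
  /-- new state, from the old state, the fresh random bits and the received messages -/
  step : State → (Fin bits → Bool) → Multiset Msg → State
  /-- output of a node at the end of a round -/
  out : State → Option Bool

/-- The random bits of all nodes in all rounds: `ω r v` are the bits of node `v` in round `r`. -/
abbrev Tape (V : Type) (b : ℕ) := ℕ → V → Fin b → Bool

/-- All random bits are fair and independent. -/
noncomputable def tapeMeasure (V : Type) [Fintype V] (b : ℕ) : Measure (Tape V b) :=
  Measure.infinitePi fun _ : ℕ => Measure.pi fun _ : V =>
    (PMF.uniformOfFintype (Fin b → Bool)).toMeasure

open Classical in
/-- The state of node `v` at the beginning of round `r` (so `run … (r + 1) v` is its state at the end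
of round `r`). A node that is still asleep stays in its initial state. -/
noncomputable def Alg.run (A : Alg) {V : Type} [Fintype V] (ident : V → ℕ) (G : ℕ → Net V)
    (ω : Tape V A.bits) : ℕ → V → A.State
  | 0, v => A.init (ident v)
  | r + 1, v =>
    if v ∈ (G r).verts then
      A.step (A.run ident G ω r v) (ω r v)
        (((Finset.univ.filter fun u => (G r).Adj v u).val).map fun u =>
          A.send (A.run ident G ω r u) (ω r u))
    else A.run ident G ω r v

/-- The output vector of round `r`. -/
noncomputable def Alg.output (A : Alg) {V : Type} [Fintype V] (ident : V → ℕ) (G : ℕ → Net V)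
    (ω : Tape V A.bits) (r : ℕ) (v : V) : Option Bool :=
  A.out (A.run ident G ω (r + 1) v)

/-! ### Adversaries -/

/-- A `ρ`-oblivious adversary against an algorithm with `b` random bits per node and round: it
provides the dynamic graph, where the graph of round `r` may depend in any way on all random bits
except those of the last `ρ` rounds `r - ρ + 1, …, r` (and of later rounds). Initially all nodes are
asleep, and the set of awake nodes is increasing. -/
structure Adversary (V : Type) (b ρ : ℕ) where
  /-- the graph of each round, given the random bits -/
  graph : Tape V b → ℕ → Net V
  verts_zero : ∀ ω, (graph ω 0).verts = ∅
  verts_mono : ∀ ω, Monotone fun r => (graph ω r).verts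
  oblivious : ∀ ω ω' r, (∀ s, s + ρ ≤ r → ω s = ω' s) → graph ω r = graph ω' r

/-- The guarantees for an execution of `L` rounds (after round `0`, in which all nodes sleep): the
output is a `T`-dynamic solution for MIS in every round, and the output of every node whose
`2`-neighborhood is static in `[r, r₂]` does not change in `[r + 2T, r₂]`. -/
def GoodExecution {V : Type} (G : ℕ → Net V) (y : ℕ → V → Option Bool) (T L : ℕ) : Prop :=
  (∀ r ≤ L, IsDynamicMIS G T r (y r)) ∧
    ∀ v r r₂, r₂ ≤ L → StaticOn G 2 v r r₂ →
      ∀ l ∈ Set.Icc (r + 2 * T) r₂, ∀ l' ∈ Set.Icc (r + 2 * T) r₂, y l v = y l' v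

end DynNet

/-!
Every node runs a *base process* in the spirit of Ghaffari's MIS algorithm, and on top of it a
pipeline of *instances* of the same process. A process keeps a set of members and, for every node, a
level `k` which encodes the desire `2⁻ᵏ` to join. In a round every node is marked with
probability `2⁻ᵏ`; a node which is not dominated joins if it is marked and none of its neighbors
is. The level goes down if the node is not dominated and the desires around it sum up to less
than `1/4`; otherwise it goes up.

* The base process runs on the current graph. Two adjacent members both leave, so after a round the
  members are independent in the graph of that round (`round_indep`), and a member whose
  neighborhood does not change stays a member.
* The instance of round `t` starts with the members of the base process at the end of round `t`
  and uses only the edges present in all rounds since `t`. Its graph can only lose edges, so its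
  members never conflict, and being a member and being dominated are permanent. The output of
  round `r` is the result of the instance of round `r + 1 - T`. It is a `T`-dynamic solution as soon
  as all nodes of the instance are decided (`isDynamicMIS_output`). If the base process has decided
  a node for good, then all later instances reproduce that decision (`StaticOn.output_eq_output`).

It remains to show that nodes are decided fast, in the instances and, for static 2-neighborhoods,
in the base process. Both are cases of `IsProcess`. Let `p` be the desire of an undecided node `v`
and `d` the sum of the desires of its neighbors. One round changes `psi = max d (1/8) ^ 2 / p`
either by a factor of at most `49/50`, or by at most `8`, and in the latter case `v` is decided
with probability at least `1/80` (`potential_drift`). Indeed, if `v` has many low-degree neighbors,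
one of them is likely to join; if not, most of `d` is halved; and if `d` is small, then `p` doubles
or `v` itself may join. Only neighbors that remain neighbors in the next round matter; this is
where 2-obliviousness enters, since the graphs of a round and of its successor do not depend on the
bits of the round. For a small power `δ`, the expectation of `psi ^ δ` on the event that `v` is
undecided therefore shrinks by a constant factor per round (`lintegral_potential_le`), and since
`psi` lies between `1/8` and a polynomial in `n`, Markov's inequality gives
`IsProcess.measure_undecided_le`. A union bound over nodes and rounds finishes the proof.
-/

namespace DynNet

/-! ### The algorithm -/

/-- The status of a node in one process: whether it is a member, whether it is permanently dominated
(used by instances only), and its level `lvl`, which stands for the desire `2 ^ (-lvl)` to join. -/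
structure Core where
  inM : Prop
  dom : Prop
  lvl : ℕ

/-- A node of level `k` is marked if the first `k` of its fresh random bits are all `true`.
All processes of a node share the same bits. -/
def Marked {b : ℕ} (k : ℕ) (x : Fin b → Bool) : Prop := ∀ i : Fin b, i.val < k → x i = true

/-- The desire to join. -/
noncomputable def Core.weight (c : Core) : ℝ := (1 / 2) ^ c.lvl

open Classical in
/-- One round of a process at a node with status `c` and fresh bits `x`, if `ms` are the statuses
and bits of its neighbors. Levels stay between `3` and `b`. Dominated nodes and members still mark
themselves and count in the sums of desires, but their levels go up. -/
noncomputable def Core.step {b : ℕ} (c : Core) (x : Fin b → Bool)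
    (ms : Multiset (Core × (Fin b → Bool))) : Core where
  inM := (c.inM ∧ ∀ m ∈ ms, ¬ m.1.inM) ∨
    ((¬ c.inM ∧ ¬ c.dom ∧ ∀ m ∈ ms, ¬ m.1.inM) ∧ Marked c.lvl x ∧
      ∀ m ∈ ms, ¬ Marked m.1.lvl m.2)
  dom := ¬ c.inM ∧ (c.dom ∨ ∃ m ∈ ms, m.1.inM)
  lvl := if (¬ c.inM ∧ ¬ c.dom ∧ ∀ m ∈ ms, ¬ m.1.inM) ∧
      (ms.map fun m => m.1.weight).sum < 1 / 4 then max 3 (c.lvl - 1) else min b (c.lvl + 1)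

/-- In the base process no domination is permanent. -/
def Core.release (c : Core) : Core := { c with dom := False }

/-- The state of a node: its identifier, its status in the base process, and, for every `j`, its
status in the instance that started `j` rounds ago together with the identifiers of the nodes to
which it has been adjacent in all rounds of that instance. -/
structure NodeState where
  ident : ℕ
  base : Core
  inst : ℕ → Core
  nbr : ℕ → Set ℕ

open Classical in
/-- The algorithm with `b` random bits per node and round. A message consists of the whole state and
the fresh bits. The output is the result of the instance that started `T - 1` rounds ago. -/
noncomputable def misAlg (b T : ℕ) : Alg where
  bits := b
  State := NodeState
  Msg := NodeState × (Fin b → Bool)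
  init i := ⟨i, ⟨False, False, 3⟩, fun _ => ⟨False, False, 3⟩, fun _ => ∅⟩
  send s x := (s, x)
  step s x ms :=
    { ident := s.ident
      base := (s.base.step x (ms.map fun m => (m.1.base, m.2))).release
      inst := fun j => match j with
        | 0 => (s.base.step x (ms.map fun m => (m.1.base, m.2))).release
        | j + 1 => (s.inst j).step x
            ((ms.filter fun m => m.1.ident ∈ s.nbr j).map fun m => (m.1.inst j, m.2))
      nbr := fun j => match j with
        | 0 => {i | ∃ m ∈ ms, m.1.ident = i}
        | j + 1 => s.nbr j ∩ {i | ∃ m ∈ ms, m.1.ident = i} }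
  out s := if (s.inst (T - 1)).inM then some true
    else if (s.inst (T - 1)).dom then some false else none

/-- One round of a process at node `u`, as a function of the neighborhoods `N`, the statuses `c` and
the bits `x` of all nodes. -/
noncomputable def round {V : Type} {b : ℕ} (N : V → Finset V) (c : V → Core)
    (x : V → Fin b → Bool) (u : V) : Core :=
  (c u).step (x u) ((N u).val.map fun w => (c w, x w))

section Round
variable {V : Type} {b : ℕ} (N : V → Finset V) (c : V → Core) (x : V → Fin b → Bool)

/-- `v`, with neighborhood `S`, is neither a member nor permanently dominated nor adjacent to a
member. -/
def Undecided (v : V) (S : Finset V) (c : V → Core) : Prop :=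
  ¬ (c v).inM ∧ ¬ (c v).dom ∧ ∀ u ∈ S, ¬ (c u).inM

/-- The sum of the desires of the nodes in `S`. -/
noncomputable def nbrWeight (S : Finset V) (c : V → Core) : ℝ := ∑ u ∈ S, (c u).weight

open Classical in
/-- The level of `u` after a round; it does not depend on the random bits of the round. -/
noncomputable def nextLvl (b : ℕ) (u : V) : ℕ :=
  if Undecided u (N u) c ∧ nbrWeight (N u) c < 1 / 4 then max 3 ((c u).lvl - 1)
  else min b ((c u).lvl + 1)

lemma round_inM_iff (u : V) : (round N c x u).inM ↔
    ((c u).inM ∧ ∀ w ∈ N u, ¬ (c w).inM) ∨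
    (Undecided u (N u) c ∧ Marked (c u).lvl (x u) ∧ ∀ w ∈ N u, ¬ Marked (c w).lvl (x w)) := by
  simp [round, Core.step, Undecided]

lemma round_dom_iff (u : V) : (round N c x u).dom ↔
    ¬ (c u).inM ∧ ((c u).dom ∨ ∃ w ∈ N u, (c w).inM) := by
  simp [round, Core.step]

lemma round_lvl (u : V) : (round N c x u).lvl = nextLvl N c b u := by
  have h : ((N u).val.map fun w => (c w, x w)).map (fun m => m.1.weight) =
      (N u).val.map fun w => (c w).weight := by
    rw [Multiset.map_map]; rfl
  classical
  exact if_congr (and_congr (by simp [Undecided]) (by rw [h]; rfl)) rfl rfl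

variable {N c x}

lemma not_dom_of_round_inM {u : V} (h : (round N c x u).inM) : ¬ (round N c x u).dom := by
  rw [round_inM_iff, Undecided] at h
  rw [round_dom_iff]
  rintro ⟨h1, h2 | ⟨w, hw, h2⟩⟩
  · tauto
  · rcases h with h | h
    · exact h1 h.1
    · exact h.1.2.2 w hw h2

/-- No hypothesis on the current states is needed: a conflict between two members makes both of them
leave, and of two neighbors at most one can join. -/
lemma round_indep {u w : V} (huw : w ∈ N u) (hwu : u ∈ N w) :
    ¬ ((round N c x u).inM ∧ (round N c x w).inM) := by
  simp only [round_inM_iff, Undecided]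
  rintro ⟨h1 | h1, h2 | h2⟩
  · exact h1.2 w huw h2.1
  · exact h2.1.2.2 u hwu h1.1
  · exact h1.1.2.2 w huw h2.1
  · exact h1.2.2 w huw h2.2.1

end Round

lemma Core.step_lvl_mem {b : ℕ} (hb : 3 ≤ b) {c : Core} (hc : c.lvl ∈ Set.Icc 3 b)
    (x : Fin b → Bool) (ms : Multiset (Core × (Fin b → Bool))) :
    (c.step x ms).lvl ∈ Set.Icc 3 b := by
  simp only [Core.step, Set.mem_Icc] at hc ⊢
  split_ifs <;> omega

section Run
variable {V : Type} [Fintype V] {ident : V → ℕ} {b T : ℕ} {G : ℕ → Net V} {ω : Tape V b}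

variable (ident b T G ω) in
/-- The state of node `u` at the beginning of round `s`. -/
noncomputable def state (s : ℕ) (u : V) : NodeState := (misAlg b T).run ident G ω s u

open Classical in
/-- The nodes adjacent to `u` in all rounds `t, …, s`. -/
noncomputable def commonNbrs (G : ℕ → Net V) (t s : ℕ) (u : V) : Finset V :=
  Finset.univ.filter fun w => ∀ l ∈ Set.Icc t s, (G l).Adj u w

lemma mem_commonNbrs {t s : ℕ} {u w : V} :
    w ∈ commonNbrs G t s u ↔ ∀ l ∈ Set.Icc t s, (G l).Adj u w := by
  simp [commonNbrs]

lemma mem_commonNbrs_comm {t s : ℕ} {u w : V} :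
    w ∈ commonNbrs G t s u ↔ u ∈ commonNbrs G t s w := by
  simp only [mem_commonNbrs, SimpleGraph.Subgraph.adj_comm]

lemma mem_commonNbrs_self {s : ℕ} {u w : V} : w ∈ commonNbrs G s s u ↔ (G s).Adj u w := by
  simp [commonNbrs]

lemma commonNbrs_anti {t s s' : ℕ} (h : s ≤ s') (u : V) :
    commonNbrs G t s' u ⊆ commonNbrs G t s u := by
  intro w
  simp only [mem_commonNbrs, Set.mem_Icc]
  exact fun H l hl => H l ⟨hl.1, hl.2.trans h⟩

lemma mem_commonNbrs_succ {t k s : ℕ} {u w : V} (h : s = k + 1 ∧ t ≤ s) :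
    w ∈ commonNbrs G t s u ↔ w ∈ commonNbrs G t k u ∧ w ∈ commonNbrs G s s u := by
  simp only [mem_commonNbrs, Set.mem_Icc]
  constructor
  · exact fun H => ⟨fun l hl => H l (by omega), fun l hl => H l (by omega)⟩
  · rintro ⟨H1, H2⟩ l hl
    by_cases h' : l ≤ k
    · exact H1 l (by omega)
    · exact H2 l (by omega)

lemma not_mem_commonNbrs_self {t s : ℕ} (h : t ≤ s) (u : V) : u ∉ commonNbrs G t s u := by
  rw [mem_commonNbrs]
  exact fun H => (G t).loopless.irrefl u (H t ⟨le_rfl, h⟩)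

lemma run_succ_of_mem (A : Alg) {η : Tape V A.bits} {s : ℕ} {u : V} (hu : u ∈ (G s).verts) :
    A.run ident G η (s + 1) u = A.step (A.run ident G η s u) (η s u)
      ((commonNbrs G s s u).val.map fun w => A.send (A.run ident G η s w) (η s w)) := by
  classical
  have : commonNbrs G s s u = (Finset.univ.filter fun w => (G s).Adj u w) := by
    ext w; simp [mem_commonNbrs_self]
  rw [this]
  refine (if_pos hu).trans ?_
  congr!

lemma run_succ_of_notMem (A : Alg) {η : Tape V A.bits} {s : ℕ} {u : V} (hu : u ∉ (G s).verts) :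
    A.run ident G η (s + 1) u = A.run ident G η s u :=
  if_neg hu

lemma state_succ {s : ℕ} {u : V} (hu : u ∈ (G s).verts) :
    state ident b T G ω (s + 1) u = (misAlg b T).step (state ident b T G ω s u) (ω s u)
      ((commonNbrs G s s u).val.map fun w => (state ident b T G ω s w, ω s w)) := by
  exact run_succ_of_mem (misAlg b T) hu

lemma state_succ_of_notMem {s : ℕ} {u : V} (hu : u ∉ (G s).verts) :
    state ident b T G ω (s + 1) u = state ident b T G ω s u :=
  run_succ_of_notMem (misAlg b T) hu

lemma state_ident (s : ℕ) (u : V) : (state ident b T G ω s u).ident = ident u := by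
  induction s generalizing u with
  | zero => rfl
  | succ s ih =>
    by_cases hu : u ∈ (G s).verts
    · rw [state_succ hu]; exact ih u
    · rw [state_succ_of_notMem hu]; exact ih u

lemma state_lvl_mem (hb : 3 ≤ b) (s : ℕ) (u : V) :
    (state ident b T G ω s u).base.lvl ∈ Set.Icc 3 b ∧
      ∀ j, ((state ident b T G ω s u).inst j).lvl ∈ Set.Icc 3 b := by
  induction s generalizing u with
  | zero => exact ⟨⟨le_rfl, hb⟩, fun _ => ⟨le_rfl, hb⟩⟩
  | succ s ih =>
    by_cases hu : u ∈ (G s).verts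
    · rw [state_succ hu]
      refine ⟨Core.step_lvl_mem hb (ih u).1 (ω s u) _, fun j => ?_⟩
      cases j with
      | zero => exact Core.step_lvl_mem hb (ih u).1 (ω s u) _
      | succ j => exact Core.step_lvl_mem hb ((ih u).2 j) (ω s u) _
    · rw [state_succ_of_notMem hu]; exact ih u

lemma base_succ {s : ℕ} {u : V} (hu : u ∈ (G s).verts) :
    (state ident b T G ω (s + 1) u).base =
      (round (commonNbrs G s s) (fun w => (state ident b T G ω s w).base) (ω s) u).release := by
  rw [state_succ hu]
  simp only [misAlg, Multiset.map_map]
  rfl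

lemma inst_zero {s : ℕ} {u : V} (hu : u ∈ (G s).verts) :
    (state ident b T G ω (s + 1) u).inst 0 = (state ident b T G ω (s + 1) u).base := by
  rw [state_succ hu]; rfl

variable (ident b T G ω) in
/-- The status of `u` in the instance of round `t`, after `j` rounds of that instance. -/
noncomputable def instCore (t j : ℕ) (u : V) : Core := (state ident b T G ω (t + 1 + j) u).inst j

lemma state_nbr (hi : Function.Injective ident) (hG : Monotone fun r => (G r).verts) {t : ℕ}
    {u : V} (hu : u ∈ (G t).verts) (j : ℕ) : (state ident b T G ω (t + 1 + j) u).nbr j =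
      ident '' {w | w ∈ commonNbrs G t (t + j) u} := by
  induction j with
  | zero =>
    rw [add_zero, state_succ hu]
    ext i
    simp [misAlg, state_ident]
  | succ j ih =>
    have hu' : u ∈ (G (t + 1 + j)).verts := hG (show t ≤ t + 1 + j by omega) hu
    rw [show t + 1 + (j + 1) = t + 1 + j + 1 by ring, state_succ hu']
    have key : (((misAlg b T).step (state ident b T G ω (t + 1 + j) u) (ω (t + 1 + j) u)
        ((commonNbrs G (t + 1 + j) (t + 1 + j) u).val.map fun w =>
          (state ident b T G ω (t + 1 + j) w, ω (t + 1 + j) w))) : NodeState).nbr (j + 1) =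
        (state ident b T G ω (t + 1 + j) u).nbr j ∩
          {i | ∃ m ∈ ((commonNbrs G (t + 1 + j) (t + 1 + j) u).val.map fun w =>
          (state ident b T G ω (t + 1 + j) w, ω (t + 1 + j) w)), m.1.ident = i} := rfl
    rw [key, ih]
    have hs : {w | w ∈ commonNbrs G t (t + (j + 1)) u} =
        {w | w ∈ commonNbrs G t (t + j) u} ∩ {w | w ∈ commonNbrs G (t + 1 + j) (t + 1 + j) u} := by
      ext w
      rw [Set.mem_inter_iff, Set.mem_ofPred_eq, Set.mem_ofPred_eq, Set.mem_ofPred_eq]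
      rw [show t + (j + 1) = t + 1 + j by ring]
      exact mem_commonNbrs_succ (by omega)
    rw [hs, Set.image_inter hi]
    congr 1
    ext i
    simp [state_ident]

lemma instCore_succ (hi : Function.Injective ident) (hG : Monotone fun r => (G r).verts) {t : ℕ}
    {u : V} (hu : u ∈ (G t).verts) (j : ℕ) :
    instCore ident b T G ω t (j + 1) u =
      round (commonNbrs G t (t + 1 + j)) (instCore ident b T G ω t j) (ω (t + 1 + j)) u := by
  classical
  have hu' : u ∈ (G (t + 1 + j)).verts := hG (show t ≤ t + 1 + j by omega) hu
  rw [instCore, show t + 1 + (j + 1) = t + 1 + j + 1 by ring, state_succ hu']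
  have hN : (commonNbrs G t (t + 1 + j) u) = (commonNbrs G (t + 1 + j) (t + 1 + j) u).filter
      fun w => ident w ∈ (state ident b T G ω (t + 1 + j) u).nbr j := by
    ext w
    rw [Finset.mem_filter, state_nbr hi hG hu, hi.mem_set_image, Set.mem_ofPred_eq, and_comm]
    exact mem_commonNbrs_succ (by omega)
  rw [round, hN, Finset.filter_val]
  simp only [misAlg, Multiset.filter_map, Multiset.map_map, Function.comp_def]
  rw [instCore]
  congr! 3
  rename_i w
  rw [state_ident (T := T)]

end Run

/-! ### Consequences of the transition rules -/

section Networks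
variable {V : Type} {G : ℕ → Net V}

lemma mem_interGraph_verts {T : ℕ} (hG : Monotone fun r => (G r).verts) {r : ℕ} (hT : 1 ≤ T)
    {v : V} :
    v ∈ (interGraph G T r).verts ↔ v ∈ (G (r + 1 - T)).verts := by
  simp only [interGraph, SimpleGraph.Subgraph.verts_iInf, Set.mem_iInter, window]
  exact ⟨fun h => h _ ⟨le_rfl, by omega⟩, fun h s hs => hG hs.1 h⟩

lemma StaticOn.mono {a r r₂ r₂' : ℕ} {v : V} (h : StaticOn G a v r r₂) (hr : r₂' ≤ r₂) :
    StaticOn G a v r r₂' :=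
  ⟨h.1, fun l hl l' hl' => h.2 l ⟨hl.1, hl.2.trans hr⟩ l' ⟨hl'.1, hl'.2.trans hr⟩⟩

lemma mem_nbhd_of_walk {H : Net V} {a : ℕ} {v u : V} (hu : u ∈ H.verts)
    (p : H.spanningCoe.Walk v u) (hp : p.length ≤ a) : u ∈ nbhd H a v :=
  ⟨hu, p.edist_le.trans (by exact_mod_cast hp)⟩

lemma mem_nbhd_of_adj {H : Net V} {v u : V} (huv : H.Adj v u) : u ∈ nbhd H 2 v := by
  have h : H.spanningCoe.Adj v u := huv
  exact mem_nbhd_of_walk (H.edge_vert huv.symm) h.toWalk (by simp)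

lemma mem_nbhd_of_adj_of_adj {H : Net V} {v u w : V} (huv : H.Adj v u) (huw : H.Adj u w) :
    w ∈ nbhd H 2 v := by
  have h : H.spanningCoe.Adj v u := huv
  have h' : H.spanningCoe.Adj u w := huw
  exact mem_nbhd_of_walk (H.edge_vert huw.symm) (.cons h h'.toWalk) (by simp)

section
variable {v : V} {r r₂ l l' : ℕ}

lemma StaticOn.adj_of_adj (h : StaticOn G 2 v r r₂) (hl : l ∈ Set.Icc r r₂)
    (hl' : l' ∈ Set.Icc r r₂) {u : V} (huv : (G l).Adj v u) : (G l').Adj v u := by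
  have hv := mem_nbhd_of_walk (a := 2) ((G l).edge_vert huv) SimpleGraph.Walk.nil (by simp)
  have hu := mem_nbhd_of_adj huv
  have : ((G l).induce (nbhd (G l) 2 v)).Adj v u := ⟨hv, hu, huv⟩
  rw [h.2 l hl l' hl'] at this
  exact this.2.2

lemma StaticOn.adj_adj_of_adj (h : StaticOn G 2 v r r₂) (hl : l ∈ Set.Icc r r₂)
    (hl' : l' ∈ Set.Icc r r₂) {u w : V} (huv : (G l).Adj v u) (huw : (G l).Adj u w) :
    (G l').Adj u w := by
  have hu := mem_nbhd_of_adj huv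
  have hw := mem_nbhd_of_adj_of_adj huv huw
  have : ((G l).induce (nbhd (G l) 2 v)).Adj u w := ⟨hu, hw, huw⟩
  rw [h.2 l hl l' hl'] at this
  exact this.2.2

end
end Networks

section Deterministic
variable {V : Type} [Fintype V] {ident : V → ℕ} {b T : ℕ} {G : ℕ → Net V} {ω : Tape V b}

lemma mem_verts_of_mem_commonNbrs {t s : ℕ} (h : t ≤ s) {u w : V} (hw : w ∈ commonNbrs G t s u) :
    w ∈ (G t).verts := by
  rw [mem_commonNbrs] at hw
  exact (G t).edge_vert (hw t ⟨le_rfl, h⟩).symm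

variable (ident b T G ω) in
/-- The status of `u` in the base process at the beginning of round `s`. -/
noncomputable def baseCore (s : ℕ) (u : V) : Core := (state ident b T G ω s u).base

lemma baseCore_succ {s : ℕ} {u : V} (hu : u ∈ (G s).verts) :
    baseCore ident b T G ω (s + 1) u =
      (round (commonNbrs G s s) (baseCore ident b T G ω s) (ω s) u).release :=
  base_succ hu

lemma baseCore_indep {s : ℕ} {u w : V} (h : (G s).Adj u w) :
    ¬ ((baseCore ident b T G ω (s + 1) u).inM ∧ (baseCore ident b T G ω (s + 1) w).inM) := by
  rw [baseCore_succ ((G s).edge_vert h), baseCore_succ ((G s).edge_vert h.symm)]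
  exact round_indep (mem_commonNbrs_self.2 h) (mem_commonNbrs_self.2 h.symm)

lemma baseCore_dom {s : ℕ} {u : V} : ¬ (baseCore ident b T G ω s u).dom := by
  induction s with
  | zero => exact id
  | succ s ih =>
    by_cases hu : u ∈ (G s).verts
    · rw [baseCore_succ hu]; exact id
    · rw [baseCore, state_succ_of_notMem hu]; exact ih

lemma instCore_zero {t : ℕ} {u : V} (hu : u ∈ (G t).verts) :
    instCore ident b T G ω t 0 u = baseCore ident b T G ω (t + 1) u :=
  inst_zero hu

section Inst
variable (hi : Function.Injective ident) (hG : Monotone fun r => (G r).verts) {t : ℕ}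
include hi hG

lemma instCore_indep {j : ℕ} {u w : V} (h : w ∈ commonNbrs G t (t + j) u) :
    ¬ ((instCore ident b T G ω t j u).inM ∧ (instCore ident b T G ω t j w).inM) := by
  have hw := mem_verts_of_mem_commonNbrs (by omega) h
  have hu := mem_verts_of_mem_commonNbrs (by omega) (mem_commonNbrs_comm.1 h)
  cases j with
  | zero =>
    rw [instCore_zero hu, instCore_zero hw]
    exact baseCore_indep (mem_commonNbrs_self.1 h)
  | succ j =>
    rw [instCore_succ hi hG hu, instCore_succ hi hG hw]
    rw [show t + (j + 1) = t + 1 + j by ring] at h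
    exact round_indep h (mem_commonNbrs_comm.1 h)

lemma instCore_inM_mono {j k : ℕ} (hjk : j ≤ k) {u : V} (hu : u ∈ (G t).verts)
    (h : (instCore ident b T G ω t j u).inM) : (instCore ident b T G ω t k u).inM := by
  induction k, hjk using Nat.le_induction with
  | base => exact h
  | succ k _ ih =>
    rw [instCore_succ hi hG hu, round_inM_iff]
    exact Or.inl ⟨ih, fun w hw hwM => instCore_indep hi hG
      (commonNbrs_anti (by omega) u hw) ⟨ih, hwM⟩⟩

lemma not_dom_of_instCore_inM {j : ℕ} {u : V} (hu : u ∈ (G t).verts)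
    (h : (instCore ident b T G ω t j u).inM) : ¬ (instCore ident b T G ω t j u).dom := by
  cases j with
  | zero => rw [instCore_zero hu]; exact baseCore_dom
  | succ j => rw [instCore_succ hi hG hu] at h ⊢; exact not_dom_of_round_inM h

lemma instCore_dom_mono {j k : ℕ} (hjk : j ≤ k) {u : V} (hu : u ∈ (G t).verts)
    (h : (instCore ident b T G ω t j u).dom) : (instCore ident b T G ω t k u).dom := by
  induction k, hjk using Nat.le_induction with
  | base => exact h
  | succ k _ ih =>
    rw [instCore_succ hi hG hu, round_dom_iff]
    exact ⟨fun hM => not_dom_of_instCore_inM hi hG hu hM ih, Or.inl ih⟩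

/-- A dominated node of an instance was adjacent to a member in some round of the window, and the
dominating node is still a member. -/
lemma exists_dominator {j : ℕ} {v : V} (hv : v ∈ (G t).verts)
    (h : (instCore ident b T G ω t j v).dom) :
    ∃ u ∈ (G t).verts, (∃ s ∈ Set.Icc t (t + j), (G s).Adj v u) ∧
      (instCore ident b T G ω t j u).inM := by
  induction j with
  | zero => rw [instCore_zero hv] at h; exact absurd h baseCore_dom
  | succ j ih =>
    rw [instCore_succ hi hG hv, round_dom_iff] at h
    rcases h.2 with h' | ⟨w, hw, hwM⟩
    · obtain ⟨u, hu, ⟨s, hs, hadj⟩, huM⟩ := ih h'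
      exact ⟨u, hu, ⟨s, ⟨hs.1, by have := hs.2; omega⟩, hadj⟩,
        instCore_inM_mono hi hG (Nat.le_succ j) hu huM⟩
    · have hwt := mem_verts_of_mem_commonNbrs (by omega) hw
      exact ⟨w, hwt, ⟨t + 1 + j, ⟨by omega, by omega⟩,
        mem_commonNbrs.1 hw _ ⟨by omega, le_rfl⟩⟩,
        instCore_inM_mono hi hG (Nat.le_succ j) hwt hwM⟩

lemma decided_instCore_succ {j : ℕ} {v : V} (hv : v ∈ (G t).verts)
    (h : ¬ Undecided v (commonNbrs G t (t + 1 + j) v) (instCore ident b T G ω t j)) :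
    (instCore ident b T G ω t (j + 1) v).inM ∨ (instCore ident b T G ω t (j + 1) v).dom := by
  by_cases hM : (instCore ident b T G ω t j v).inM
  · exact Or.inl (instCore_inM_mono hi hG (Nat.le_succ j) hv hM)
  · right
    rw [instCore_succ hi hG hv, round_dom_iff]
    refine ⟨hM, ?_⟩
    unfold Undecided at h
    push Not at h
    by_cases hd : (instCore ident b T G ω t j v).dom
    · exact Or.inl hd
    · exact Or.inr (h hM hd)

end Inst

open Classical in
lemma output_eq {t r : ℕ} (hr : t + (T - 1) = r) (v : V) :
    (misAlg b T).output ident G ω r v =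
      if (instCore ident b T G ω t (T - 1) v).inM then some true
      else if (instCore ident b T G ω t (T - 1) v).dom then some false else none := by
  subst hr
  rw [instCore, show t + 1 + (T - 1) = t + (T - 1) + 1 by ring]
  rfl

/-- The output of round `r` is a `T`-dynamic solution if every node of the instance of round
`r + 1 - T` is decided one round before. A node next to a new member needs that last round to learn
of it and to become permanently dominated. -/
theorem isDynamicMIS_output (hi : Function.Injective ident)
    (hG : Monotone fun r => (G r).verts) (h0 : (G 0).verts = ∅) (hT : 2 ≤ T) {r : ℕ}
    (h : ∀ v ∈ (G (r + 1 - T)).verts, ¬ Undecided v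
      (commonNbrs G (r + 1 - T) (r + 1 - T + 1 + (T - 2)) v)
      (instCore ident b T G ω (r + 1 - T) (T - 2))) :
    IsDynamicMIS G T r ((misAlg b T).output ident G ω r) := by
  have hT1 : 1 ≤ T := by omega
  set t := r + 1 - T with ht
  by_cases htr : r + 1 ≤ T
  · have ht0 : t = 0 := by omega
    have hv : ∀ v, v ∉ (interGraph G T r).verts := by
      intro v hv
      rw [mem_interGraph_verts hG hT1, ← ht, ht0, h0] at hv
      exact hv
    exact ⟨⟨fun v h' => absurd h' (hv v), fun u v h' => absurd ((interGraph G T r).edge_vert h')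
      (hv u)⟩, ⟨fun v h' => absurd h' (hv v), fun v h' => absurd h' (hv v)⟩⟩
  have hr : t + (T - 1) = r := by omega
  have hdec : ∀ v ∈ (G t).verts, (instCore ident b T G ω t (T - 1) v).inM ∨
      (instCore ident b T G ω t (T - 1) v).dom := by
    intro v hv
    have := decided_instCore_succ hi hG hv (h v hv)
    rwa [show T - 2 + 1 = T - 1 by omega] at this
  have hne : ∀ v ∈ (G t).verts, (misAlg b T).output ident G ω r v ≠ none := by
    intro v hv
    rw [output_eq hr]
    rcases hdec v hv with h1 | h1 <;> simp [h1]
    split_ifs <;> simp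
  have htrue : ∀ v, (misAlg b T).output ident G ω r v = some true ↔
      (instCore ident b T G ω t (T - 1) v).inM := by
    intro v
    rw [output_eq hr]
    split_ifs <;> simp_all
  refine ⟨⟨fun v hv => hne v ((mem_interGraph_verts hG hT1).1 hv), fun u v huv => ?_⟩,
    ⟨fun v hv => hne v ((mem_interGraph_verts hG hT1).1 hv), fun v hv => ?_⟩⟩
  · rw [htrue, htrue]
    refine instCore_indep hi hG (mem_commonNbrs.2 fun l hl => ?_)
    simp only [interGraph, SimpleGraph.Subgraph.iInf_adj, window] at huv
    exact huv.1 l |>.1 ⟨hl.1, by have := hl.2; omega⟩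
  · have hvt := (mem_interGraph_verts hG hT1).1 hv
    rcases hdec v hvt with h1 | h1
    · exact Or.inl ((htrue v).2 h1)
    · obtain ⟨u, hu, ⟨s, hs, hadj⟩, huM⟩ := exists_dominator hi hG hvt h1
      refine Or.inr ⟨u, ?_, (htrue u).2 huM⟩
      simp only [unionGraph, SimpleGraph.Subgraph.induce_adj, SimpleGraph.Subgraph.iSup_adj]
      exact ⟨hv, (mem_interGraph_verts hG hT1).2 hu, s, ⟨hs.1, by have := hs.2; omega⟩, hadj⟩

section Static
variable {v : V} {r r₂ l l' : ℕ}

lemma StaticOn.commonNbrs_eq (h : StaticOn G 2 v r r₂) (hl : l ∈ Set.Icc r r₂)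
    (hl' : l' ∈ Set.Icc r r₂) : commonNbrs G l l v = commonNbrs G l' l' v := by
  ext u
  rw [mem_commonNbrs_self, mem_commonNbrs_self]
  exact ⟨h.adj_of_adj hl hl', h.adj_of_adj hl' hl⟩

lemma baseCore_inM_succ {s : ℕ} {u : V} (hu : u ∈ (G (s + 1)).verts)
    (hs : ∀ w, (G (s + 1)).Adj u w → (G s).Adj u w)
    (h : (baseCore ident b T G ω (s + 1) u).inM) : (baseCore ident b T G ω (s + 2) u).inM := by
  rw [baseCore_succ hu]
  refine (round_inM_iff ..).2 (Or.inl ⟨h, fun w hw hwM => ?_⟩)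
  exact baseCore_indep (hs w (mem_commonNbrs_self.1 hw)) ⟨h, hwM⟩

lemma StaticOn.baseCore_nbr_inM_succ (h : StaticOn G 2 v r r₂) {s : ℕ} (hs : r ≤ s)
    (hs' : s + 1 ≤ r₂) {u : V} (hu : (G (s + 1)).Adj v u)
    (hM : (baseCore ident b T G ω (s + 1) u).inM) : (baseCore ident b T G ω (s + 2) u).inM :=
  DynNet.baseCore_inM_succ ((G (s + 1)).edge_vert hu.symm)
    (fun _ => h.adj_adj_of_adj ⟨by omega, hs'⟩ ⟨hs, by omega⟩ hu) hM

variable (hG : Monotone fun r => (G r).verts)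
include hG

lemma StaticOn.baseCore_inM_succ (h : StaticOn G 2 v r r₂) {s : ℕ} (hs : r ≤ s) (hs' : s + 1 ≤ r₂)
    (hM : (baseCore ident b T G ω (s + 1) v).inM) : (baseCore ident b T G ω (s + 2) v).inM :=
  DynNet.baseCore_inM_succ (hG (show r ≤ s + 1 by omega) h.1)
    (fun _ => h.adj_of_adj ⟨by omega, hs'⟩ ⟨hs, by omega⟩) hM

/-- In a static 2-neighborhood, `v` and its neighbors have unchanged neighborhoods, so the members
among them stay members. -/
lemma StaticOn.undecided_of_undecided_succ (h : StaticOn G 2 v r r₂) {s : ℕ} (hs : r + 1 ≤ s)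
    (hs' : s + 1 ≤ r₂)
    (hU : Undecided v (commonNbrs G (s + 1) (s + 1) v) (baseCore ident b T G ω (s + 1))) :
    Undecided v (commonNbrs G s s v) (baseCore ident b T G ω s) := by
  obtain ⟨s, rfl⟩ : ∃ k, s = k + 1 := ⟨s - 1, by omega⟩
  refine ⟨fun hM => hU.1 (h.baseCore_inM_succ hG (by omega) (by omega) hM), baseCore_dom,
    fun u hu hM => ?_⟩
  have hadj := mem_commonNbrs_self.1 hu
  refine hU.2.2 u ?_ (h.baseCore_nbr_inM_succ (by omega) (by omega) hadj hM)
  rwa [h.commonNbrs_eq (l := s + 1 + 1) (l' := s + 1) ⟨by omega, hs'⟩ ⟨by omega, by omega⟩]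

/-- If the base process has decided `v` after `T` static rounds, the output of `v` is constant from
`T` rounds later on, when the instances deciding it have started after that time. Here `T ≥ 2` gives an
instance the round in which `v` learns of its dominator. -/
theorem StaticOn.output_eq_output (hi : Function.Injective ident) (hT : 2 ≤ T)
    (h : StaticOn G 2 v r r₂)
    (hdec : ¬ Undecided v (commonNbrs G (r + T) (r + T) v) (baseCore ident b T G ω (r + T)))
    (hl : l ∈ Set.Icc (r + 2 * T) r₂) (hl' : l' ∈ Set.Icc (r + 2 * T) r₂) :
    (misAlg b T).output ident G ω l v = (misAlg b T).output ident G ω l' v := by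
  have hv : ∀ s, r ≤ s → v ∈ (G s).verts := fun s hs => hG hs h.1
  by_cases hM : (baseCore ident b T G ω (r + T) v).inM
  · have hbase : ∀ s, r + T ≤ s → s ≤ r₂ → (baseCore ident b T G ω s v).inM := by
      intro s hs hs'
      induction s, hs using Nat.le_induction with
      | base => exact hM
      | succ s hs ih =>
        obtain ⟨k, rfl⟩ : ∃ k, s = k + 1 := ⟨s - 1, by omega⟩
        exact h.baseCore_inM_succ hG (by omega) (by omega) (ih (by omega))
    have key : ∀ l ∈ Set.Icc (r + 2 * T) r₂,
        (misAlg b T).output ident G ω l v = some true := by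
      rintro l ⟨h1, h2⟩
      rw [output_eq (t := l + 1 - T) (by omega), if_pos]
      refine instCore_inM_mono hi hG (Nat.zero_le _) (hv _ (by omega)) ?_
      rw [instCore_zero (hv _ (by omega))]
      exact hbase _ (by omega) (by omega)
    rw [key l hl, key l' hl']
  · obtain ⟨u, hu, huM⟩ : ∃ u ∈ commonNbrs G (r + T) (r + T) v,
        (baseCore ident b T G ω (r + T) u).inM := by
      by_contra! hcon
      exact hdec ⟨hM, baseCore_dom, hcon⟩
    have hr₂ : r + T ≤ r₂ := by have := hl.1; have := hl.2; omega
    have hadj : ∀ s, r ≤ s → s ≤ r₂ → (G s).Adj v u := fun s hs hs' =>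
      h.adj_of_adj ⟨by omega, hr₂⟩ ⟨hs, hs'⟩ (mem_commonNbrs_self.1 hu)
    have hbase : ∀ s, r + T ≤ s → s ≤ r₂ → (baseCore ident b T G ω s u).inM := by
      intro s hs hs'
      induction s, hs using Nat.le_induction with
      | base => exact huM
      | succ s hs ih =>
        obtain ⟨k, rfl⟩ : ∃ k, s = k + 1 := ⟨s - 1, by omega⟩
        exact h.baseCore_nbr_inM_succ (by omega) (by omega) (hadj _ (by omega) (by omega))
          (ih (by omega))
    have key : ∀ l ∈ Set.Icc (r + 2 * T) r₂,
        (misAlg b T).output ident G ω l v = some false := by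
      rintro l ⟨h1, h2⟩
      obtain ⟨t, ht⟩ : ∃ t, t = l + 1 - T := ⟨_, rfl⟩
      have hvt := hv t (by omega)
      have hut : u ∈ (G t).verts := (G t).edge_vert (hadj t (by omega) (by omega)).symm
      have huM0 : (instCore ident b T G ω t 0 u).inM := by
        rw [instCore_zero hut]; exact hbase _ (by omega) (by omega)
      have hnbr : ∀ k, k ≤ l → u ∈ commonNbrs G t k v := fun k hk =>
        mem_commonNbrs.2 fun s hs => hadj s (by have := hs.1; omega) (by have := hs.2; omega)
      have hvM0 : ¬ (instCore ident b T G ω t 0 v).inM := fun hvM =>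
        instCore_indep hi hG (hnbr (t + 0) (by omega)) ⟨hvM, huM0⟩
      have hdom : (instCore ident b T G ω t (T - 1) v).dom := by
        refine instCore_dom_mono hi hG (j := 1) (by omega) hvt ?_
        rw [instCore_succ hi hG hvt, round_dom_iff]
        exact ⟨hvM0, Or.inr ⟨u, hnbr _ (by omega), huM0⟩⟩
      rw [output_eq (t := t) (by omega),
        if_neg fun hM' => not_dom_of_instCore_inM hi hG hvt hM' hdom, if_pos hdom]
    rw [key l hl, key l' hl']

end Static
end Deterministic

/-! ### One round with fresh random bits -/

section Coins

/-- The bits of one node in one round. -/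
noncomputable def coin (b : ℕ) : Measure (Fin b → Bool) :=
  (PMF.uniformOfFintype (Fin b → Bool)).toMeasure

instance (b : ℕ) : IsProbabilityMeasure (coin b) := by unfold coin; infer_instance

lemma coin_marked {b k : ℕ} (hk : k ≤ b) :
    (coin b).real {x | Marked k x} = (1 / 2) ^ k := by
  classical
  have hcard : Fintype.card {x : Fin b → Bool // Marked k x} = 2 ^ (b - k) := by
    have : (Finset.univ.filter fun x : Fin b → Bool => Marked k x) =
        Fintype.piFinset fun i : Fin b => if i.val < k then {true} else Finset.univ := by
      ext x
      rw [Finset.mem_filter, Fintype.mem_piFinset, and_iff_right (Finset.mem_univ x), Marked]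
      refine forall_congr' fun i => ?_
      split_ifs with h <;> simp [h]
    rw [Fintype.card_subtype, this, Fintype.card_piFinset]
    have h2 : ∀ i : Fin b, (if i.val < k then ({true} : Finset Bool) else Finset.univ).card =
        if i.val < k then 1 else 2 := by
      intro i; split_ifs <;> simp
    simp_rw [h2]
    rw [Fin.prod_univ_eq_prod_range (fun i => if i < k then 1 else 2) b, Finset.prod_ite]
    simp only [Finset.prod_const_one, one_mul, Finset.prod_const]
    congr 1
    have : (Finset.range b).filter (fun i => ¬ i < k) = Finset.Ico k b := by
      ext i; simp; omega
    rw [this, Nat.card_Ico]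
  rw [Measure.real, coin, PMF.toMeasure_uniformOfFintype_apply _ (Set.toFinite _).measurableSet]
  have h3 : Fintype.card ↑{x : Fin b → Bool | Marked k x} = 2 ^ (b - k) := by
    rw [← hcard]; exact Fintype.card_congr (Equiv.refl _)
  rw [h3]
  simp only [Fintype.card_pi, Fintype.card_bool, Finset.prod_const, Finset.card_univ,
    Fintype.card_fin, Nat.cast_pow, Nat.cast_ofNat, ENNReal.toReal_div, ENNReal.toReal_pow,
    ENNReal.toReal_ofNat]
  rw [one_div, inv_pow, eq_comm, inv_eq_iff_eq_inv, inv_div, eq_div_iff (by positivity), ← pow_add]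
  congr 1; omega

/-- The bits of all nodes in one round. -/
noncomputable def roundMeasure (V : Type) [Fintype V] (b : ℕ) : Measure (V → Fin b → Bool) :=
  Measure.pi fun _ => coin b

instance (V : Type) [Fintype V] (b : ℕ) : IsProbabilityMeasure (roundMeasure V b) := by
  unfold roundMeasure; infer_instance

lemma one_sub_sum_le_prod_one_sub {ι : Type*} (S : Finset ι) (p : ι → ℝ)
    (h0 : ∀ i ∈ S, 0 ≤ p i) (h1 : ∀ i ∈ S, p i ≤ 1) :
    1 - ∑ i ∈ S, p i ≤ ∏ i ∈ S, (1 - p i) := by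
  classical
  induction S using Finset.induction_on with
  | empty => simp
  | insert a S ha ih =>
    rw [Finset.sum_insert ha, Finset.prod_insert ha]
    have := ih (fun i hi => h0 i (Finset.mem_insert_of_mem hi))
      (fun i hi => h1 i (Finset.mem_insert_of_mem hi))
    have hS : 0 ≤ ∑ i ∈ S, p i :=
      Finset.sum_nonneg fun i hi => h0 i (Finset.mem_insert_of_mem hi)
    have ha0 := h0 a (Finset.mem_insert_self _ _)
    have ha1 := h1 a (Finset.mem_insert_self _ _)
    nlinarith [mul_le_mul_of_nonneg_left this (sub_nonneg.2 ha1), mul_nonneg ha0 hS]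

variable {V : Type} [Fintype V] {b : ℕ}

/-- The probability that `u` is marked and no node of `S` is, by independence and a union bound. -/
lemma roundMeasure_marked_alone (k : V → ℕ) (hk : ∀ u, k u ≤ b) {u : V} {S : Finset V}
    (hu : u ∉ S) : (1 / 2) ^ k u * (1 - ∑ w ∈ S, (1 / 2 : ℝ) ^ k w) ≤
      (roundMeasure V b).real {x | Marked (k u) (x u) ∧ ∀ w ∈ S, ¬ Marked (k w) (x w)} := by
  classical
  have hset : {x : V → Fin b → Bool | Marked (k u) (x u) ∧ ∀ w ∈ S, ¬ Marked (k w) (x w)} =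
      Set.pi ↑(insert u S) fun w =>
        if w = u then {y | Marked (k w) y} else {y | Marked (k w) y}ᶜ := by
    ext x
    simp only [Set.mem_ofPred_eq, Finset.coe_insert, Set.mem_pi, Set.mem_insert_iff,
      forall_eq_or_imp, if_true, Finset.mem_coe]
    refine and_congr Iff.rfl (forall₂_congr fun w hw => ?_)
    have h : w ≠ u := fun h => hu (h ▸ hw)
    rw [if_neg h]
    rfl
  rw [hset, Measure.real, roundMeasure, ← Measure.infinitePi_eq_pi, Measure.infinitePi_pi,
    ENNReal.toReal_prod, Finset.prod_insert hu, if_pos rfl]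
  · have h1 := coin_marked (hk u)
    rw [Measure.real] at h1
    rw [h1]
    refine mul_le_mul_of_nonneg_left ?_ (by positivity)
    refine (one_sub_sum_le_prod_one_sub S _ (fun i _ => by positivity)
      (fun i _ => pow_le_one₀ (by norm_num) (by norm_num))).trans_eq (Finset.prod_congr rfl ?_)
    intro w hw
    have h : w ≠ u := fun h => hu (h ▸ hw)
    rw [if_neg h, ← Measure.real, probReal_compl_eq_one_sub
      (Set.toFinite _).measurableSet, coin_marked (hk w)]
  · intro w _
    exact (Set.toFinite _).measurableSet

lemma exists_subset_sum_mem_Icc {ι : Type*} (S : Finset ι) (p : ι → ℝ) {a β : ℝ}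
    (hβ : 0 ≤ β) (ha : 0 ≤ a) (hp : ∀ i ∈ S, p i ≤ a) (hS : β ≤ ∑ i ∈ S, p i) :
    ∃ S' ⊆ S, β ≤ ∑ i ∈ S', p i ∧ ∑ i ∈ S', p i ≤ β + a := by
  classical
  induction S using Finset.induction_on with
  | empty => exact ⟨∅, le_rfl, by simpa using hS, by simp; positivity⟩
  | insert i S hi ih =>
    by_cases h : β ≤ ∑ i ∈ S, p i
    · obtain ⟨S', h1, h2⟩ := ih (fun j hj => hp j (Finset.mem_insert_of_mem hj)) h
      exact ⟨S', h1.trans (Finset.subset_insert _ _), h2⟩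
    · refine ⟨_, Finset.Subset.refl _, hS, ?_⟩
      rw [Finset.sum_insert hi]
      have := hp i (Finset.mem_insert_self _ _)
      linarith

end Coins

section Step
variable {V : Type} [Fintype V] {b : ℕ} {N : V → Finset V} {c : V → Core}

/-- `u` joins in a round with bits `x`. -/
def Joins (N : V → Finset V) (c : V → Core) (x : V → Fin b → Bool) (u : V) : Prop :=
  Undecided u (N u) c ∧ Marked (c u).lvl (x u) ∧ ∀ w ∈ N u, ¬ Marked (c w).lvl (x w)

lemma weight_pos (c : Core) : 0 < c.weight := by unfold Core.weight; positivity

omit [Fintype V] in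
lemma nbrWeight_nonneg (S : Finset V) (c : V → Core) : 0 ≤ nbrWeight S c :=
  Finset.sum_nonneg fun u _ => (weight_pos (c u)).le

variable (hc : ∀ u, (c u).lvl ∈ Set.Icc 3 b) (hirr : ∀ u, u ∉ N u)
include hc hirr

lemma joins_prob_self {v : V} (hv : Undecided v (N v) c) (hd : nbrWeight (N v) c < 1 / 4)
    (hl : (c v).lvl = 3) : 1 / 80 ≤ (roundMeasure V b).real {x | Joins N c x v} := by
  have h := roundMeasure_marked_alone (fun u => (c u).lvl) (fun u => (hc u).2) (hirr v)
  refine le_trans ?_ (h.trans (measureReal_mono fun x hx => ⟨hv, hx⟩))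
  change (1 / 80 : ℝ) ≤ (1 / 2) ^ (c v).lvl * (1 - nbrWeight (N v) c)
  rw [hl]
  linarith

/-- If the nodes in whose surroundings the desires are small have enough desire themselves, one of
them joins with constant probability: in a subset `S` of total desire about `1/40` the events that
`u` is the only marked node of `S` and its neighborhood are disjoint. -/
lemma joins_prob_light {L : Finset V}
    (hL : ∀ u ∈ L, Undecided u (N u) c ∧ nbrWeight (N u) c < 1 / 4)
    (hw : 1 / 40 ≤ nbrWeight L c) :
    1 / 80 ≤ (roundMeasure V b).real {x | ∃ u ∈ L, Joins N c x u} := by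
  classical
  have hp : ∀ u, (c u).weight ≤ 1 / 8 := fun u => by
    have : (c u).weight ≤ (1 / 2) ^ 3 :=
      pow_le_pow_of_le_one (by norm_num) (by norm_num) (hc u).1
    linarith
  obtain ⟨S, hSL, hS1, hS2⟩ := exists_subset_sum_mem_Icc L (fun u => (c u).weight)
    (by norm_num : (0 : ℝ) ≤ 1 / 40) (by norm_num : (0 : ℝ) ≤ 1 / 8) (fun u _ => hp u) hw
  let A : V → Set (V → Fin b → Bool) := fun u =>
    {x | Marked (c u).lvl (x u) ∧ ∀ w ∈ (N u ∪ S).erase u, ¬ Marked (c w).lvl (x w)}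
  have hA : ∀ u ∈ S, (c u).weight * (1 / 2) ≤ (roundMeasure V b).real (A u) := by
    intro u hu
    refine le_trans ?_ (roundMeasure_marked_alone (fun u => (c u).lvl) (fun u => (hc u).2)
      (Finset.notMem_erase u (N u ∪ S)))
    refine mul_le_mul_of_nonneg_left ?_ (weight_pos _).le
    have h1 : ∑ w ∈ (N u ∪ S).erase u, (1 / 2 : ℝ) ^ (c w).lvl ≤
        nbrWeight (N u) c + nbrWeight S c := by
      refine (Finset.sum_le_sum_of_subset_of_nonneg (Finset.erase_subset _ _)
        fun i _ _ => by positivity).trans ?_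
      rw [nbrWeight, nbrWeight, ← Finset.sum_union_inter]
      exact le_add_of_nonneg_right (Finset.sum_nonneg fun i _ => (weight_pos _).le)
    have h2 := (hL u (hSL hu)).2
    have h3 : nbrWeight S c ≤ 1 / 40 + 1 / 8 := hS2
    linarith
  have hdisj : Set.PairwiseDisjoint ↑S A := by
    intro u hu w hw huw
    refine Set.disjoint_left.2 fun x hx hx' => ?_
    exact hx'.2 u (Finset.mem_erase.2 ⟨huw, Finset.mem_union_right _ hu⟩) hx.1
  have hsum : (roundMeasure V b).real (⋃ u ∈ S, A u) = ∑ u ∈ S, (roundMeasure V b).real (A u) :=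
    measureReal_biUnion_finset hdisj fun u _ => (Set.toFinite _).measurableSet
  calc (1 / 80 : ℝ) ≤ ∑ u ∈ S, (c u).weight * (1 / 2) := by
        rw [← Finset.sum_mul]; linarith
    _ ≤ ∑ u ∈ S, (roundMeasure V b).real (A u) := Finset.sum_le_sum hA
    _ = (roundMeasure V b).real (⋃ u ∈ S, A u) := hsum.symm
    _ ≤ _ := by
      refine measureReal_mono fun x hx => ?_
      simp only [Set.mem_iUnion] at hx
      obtain ⟨u, hu, hx⟩ := hx
      refine ⟨u, hSL hu, (hL u (hSL hu)).1, hx.1, fun w hw => hx.2 w ?_⟩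
      exact Finset.mem_erase.2 ⟨fun h => hirr u (h ▸ hw), Finset.mem_union_left _ hw⟩

omit hirr

/-- The desire of `u` after a round. -/
noncomputable def nextWeight (N : V → Finset V) (c : V → Core) (b : ℕ) (u : V) : ℝ :=
  (1 / 2) ^ nextLvl N c b u

omit [Fintype V] in
lemma half_weight_le_nextWeight (u : V) : (c u).weight / 2 ≤ nextWeight N c b u := by
  have : nextLvl N c b u ≤ (c u).lvl + 1 := by
    have := (hc u).1
    unfold nextLvl; split_ifs <;> omega
  calc (c u).weight / 2 = (1 / 2) ^ ((c u).lvl + 1) := by rw [Core.weight, pow_succ]; ring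
    _ ≤ _ := pow_le_pow_of_le_one (by norm_num) (by norm_num) this

omit [Fintype V] in
lemma nextWeight_le (u : V) : nextWeight N c b u ≤ 2 * (c u).weight := by
  have : (c u).lvl ≤ nextLvl N c b u + 1 := by
    have := (hc u).2
    unfold nextLvl; split_ifs <;> omega
  calc nextWeight N c b u = 2 * (1 / 2) ^ (nextLvl N c b u + 1) := by
        rw [nextWeight, pow_succ]; ring
    _ ≤ _ := mul_le_mul_of_nonneg_left
      (pow_le_pow_of_le_one (by norm_num) (by norm_num) this) (by norm_num)

omit [Fintype V] hc in
lemma nextWeight_le_of_heavy {u : V} (h : ¬ (Undecided u (N u) c ∧ nbrWeight (N u) c < 1 / 4)) :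
    nextWeight N c b u ≤ (c u).weight / 2 + (1 / 2) ^ b := by
  rw [nextWeight, nextLvl, if_neg h, Core.weight]
  rcases le_total b ((c u).lvl + 1) with h | h
  · rw [min_eq_left h]; exact le_add_of_nonneg_left (by positivity)
  · rw [min_eq_right h, pow_succ, mul_one_div]; exact le_add_of_nonneg_right (by positivity)

open Classical in
/-- The desires in `S` are halved, up to rounding at the maximal level, except for those of the light
nodes, which are at most doubled. -/
lemma sum_nextWeight_le {S : Finset V} (hb : 128 * Fintype.card V ≤ 2 ^ b) :
    ∑ u ∈ S, nextWeight N c b u ≤ nbrWeight S c / 2 + 3 / 2 * nbrWeight (S.filter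
      fun u => Undecided u (N u) c ∧ nbrWeight (N u) c < 1 / 4) c + 1 / 128 := by
  have h1 : ∀ u ∈ S, nextWeight N c b u ≤ (c u).weight / 2 + 3 / 2 * (if Undecided u (N u) c ∧
      nbrWeight (N u) c < 1 / 4 then (c u).weight else 0) + (1 / 2) ^ b := by
    intro u _
    have hpos : (0 : ℝ) < (1 / 2) ^ b := by positivity
    split_ifs with h
    · have := nextWeight_le (N := N) hc u; linarith
    · have := nextWeight_le_of_heavy (b := b) h; linarith
  refine (Finset.sum_le_sum h1).trans ?_
  rw [Finset.sum_add_distrib, Finset.sum_add_distrib, ← Finset.sum_div, ← Finset.mul_sum,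
    ← Finset.sum_filter, Finset.sum_const, nsmul_eq_mul]
  refine add_le_add le_rfl ?_
  have hS : (S.card : ℝ) ≤ Fintype.card V := by exact_mod_cast Finset.card_le_univ S
  have hb' : 128 * (Fintype.card V : ℝ) ≤ 2 ^ b := by exact_mod_cast hb
  rw [one_div_pow, mul_one_div, div_le_div_iff₀ (by positivity) (by norm_num)]
  linarith

end Step

section Potential
variable {V : Type} [Fintype V] {b : ℕ} {N : V → Finset V} {c : V → Core}

/-- The potential of `v` with neighborhood `S`, before taking a small power. The truncation of the
sum at `1/8`, below the threshold `1/4` for changing levels, leaves room for a decrease by `7/10` when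
the sum is above the threshold. -/
noncomputable def psi (v : V) (S : Finset V) (c : V → Core) : ℝ :=
  (max (nbrWeight S c) (1 / 8)) ^ 2 / (c v).weight

omit [Fintype V] in
lemma psi_pos (v : V) (S : Finset V) (c : V → Core) : 0 < psi v S c := by
  have : 0 < max (nbrWeight S c) (1 / 8) := lt_max_of_lt_right (by norm_num)
  have := weight_pos (c v)
  unfold psi; positivity

open Classical in
/-- The potential of `v` with neighborhood `S`, which vanishes once `v` is decided. -/
noncomputable def potential (δ : ℝ) (v : V) (S : Finset V) (c : V → Core) : ENNReal :=
  if Undecided v S c then ENNReal.ofReal (psi v S c ^ δ) else 0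

/-- The potential `q` after the round, of `v` with a possibly smaller neighborhood `S`, has dropped
by a constant factor, or it has grown by a bounded factor and `v` is decided with constant
probability. -/
lemma potential_drift (hc : ∀ u, (c u).lvl ∈ Set.Icc 3 b) (hirr : ∀ u, u ∉ N u)
    (hb : 128 * Fintype.card V ≤ 2 ^ b) {v : V} (hv : Undecided v (N v) c) {S : Finset V}
    (hS : S ⊆ N v) (q : ℝ)
    (hq : q = (max (∑ u ∈ S, nextWeight N c b u) (1 / 8)) ^ 2 / nextWeight N c b v) :
    q ≤ 49 / 50 * psi v (N v) c ∨ q ≤ 8 * psi v (N v) c ∧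
      1 / 80 ≤ (roundMeasure V b).real {x | ∃ u ∈ insert v (S : Set V), Joins N c x u} := by
  classical
  have hp : 0 < (c v).weight := weight_pos _
  have hp' : 0 < nextWeight N c b v := by unfold nextWeight; positivity
  have hp2 := half_weight_le_nextWeight (N := N) hc v
  set d := nbrWeight (N v) c with hd
  set d' := ∑ u ∈ S, nextWeight N c b u with hd'
  have hd0 : 0 ≤ d := nbrWeight_nonneg _ _
  have hSd : nbrWeight S c ≤ d :=
    Finset.sum_le_sum_of_subset_of_nonneg hS fun i _ _ => (weight_pos _).le
  have hsum := sum_nextWeight_le (N := N) (S := S) hc hb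
  set l := nbrWeight (S.filter fun u => Undecided u (N u) c ∧ nbrWeight (N u) c < 1 / 4) c
  rw [← hd'] at hsum
  have hpsi : psi v (N v) c = (max d (1 / 8)) ^ 2 / (c v).weight := rfl
  -- a bound for the new potential from bounds for its two ingredients
  have hbound : ∀ α β : ℝ, 0 ≤ α → 0 < β → max d' (1 / 8) ≤ α * max d (1 / 8) →
      β * (c v).weight ≤ nextWeight N c b v → q ≤ α ^ 2 / β * psi v (N v) c := by
    intro α β hα hβ h1 h2
    have hm : 0 ≤ max d' (1 / 8) := le_max_of_le_right (by norm_num)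
    calc q = (max d' (1 / 8)) ^ 2 / nextWeight N c b v := hq
      _ ≤ (α * max d (1 / 8)) ^ 2 / (β * (c v).weight) := by gcongr
      _ = _ := by rw [hpsi]; field_simp
  by_cases hl : 1 / 40 ≤ l
  · right
    constructor
    · have hdd : d' ≤ 2 * d := by
        refine le_trans ?_ (mul_le_mul_of_nonneg_left hSd zero_le_two)
        rw [nbrWeight, Finset.mul_sum]
        exact Finset.sum_le_sum fun u _ => nextWeight_le hc u
      have h := hbound 2 (1 / 2) (by norm_num) (by norm_num) (max_le ?_ ?_) (by linarith)
      · norm_num at h ⊢; exact h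
      · exact hdd.trans (mul_le_mul_of_nonneg_left (le_max_left _ _) zero_le_two)
      · linarith [le_max_right d (1 / 8)]
    · refine (joins_prob_light hc hirr (fun u hu => (Finset.mem_filter.1 hu).2) hl).trans ?_
      refine measureReal_mono fun x => ?_
      rintro ⟨u, hu, hj⟩
      exact ⟨u, Or.inr (Finset.mem_filter.1 hu).1, hj⟩
  · have hd'' : d' ≤ d / 2 + 29 / 640 := by linarith
    by_cases h4 : 1 / 4 ≤ d
    · left
      have h := hbound (7 / 10) (1 / 2) (by norm_num) (by norm_num) (max_le ?_ ?_) (by linarith)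
      · norm_num at h ⊢; exact h
      · linarith [le_max_left d (1 / 8)]
      · linarith [le_max_left d (1 / 8)]
    · have hm : max d' (1 / 8) ≤ 1 * max d (1 / 8) := by
        refine max_le ?_ ?_
        · linarith [le_max_left d (1 / 8), le_max_right d (1 / 8)]
        · linarith [le_max_right d (1 / 8)]
      have hlight : Undecided v (N v) c ∧ nbrWeight (N v) c < 1 / 4 := ⟨hv, not_le.1 h4⟩
      by_cases h3 : (c v).lvl = 3
      · right
        have hnext : nextLvl N c b v = 3 := by rw [nextLvl, if_pos hlight]; omega
        constructor
        · have h := hbound 1 1 (by norm_num) (by norm_num) hm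
            (by rw [nextWeight, hnext, Core.weight, h3]; norm_num)
          have := psi_pos v (N v) c
          norm_num at h; linarith
        · refine (joins_prob_self hc hirr hv hlight.2 h3).trans (measureReal_mono fun x hx => ?_)
          exact ⟨v, Or.inl rfl, hx⟩
      · left
        have h3' := (hc v).1
        have hnext : nextLvl N c b v + 1 = (c v).lvl := by
          rw [nextLvl, if_pos hlight]; omega
        have h := hbound 1 2 (by norm_num) (by norm_num) hm
          (by rw [nextWeight, Core.weight, ← hnext, pow_succ]; linarith)
        have := psi_pos v (N v) c
        norm_num at h; linarith

/-- The expected potential shrinks by a constant factor in every round. The new statuses `c'` are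
only required to agree with `round` in membership and level, and only at `v` and its remaining
neighbors, so that both the base process and the instances are covered. -/
theorem lintegral_potential_le (hc : ∀ u, (c u).lvl ∈ Set.Icc 3 b) (hirr : ∀ u, u ∉ N u)
    (hb : 128 * Fintype.card V ≤ 2 ^ b) {v : V} (hv : Undecided v (N v) c) {S : Finset V}
    (hS : S ⊆ N v) {c' : (V → Fin b → Bool) → V → Core}
    (hc' : ∀ x, ∀ u ∈ insert v (S : Set V), ((c' x u).inM ↔ (round N c x u).inM) ∧
      (c' x u).lvl = (round N c x u).lvl)
    {δ ρ : ℝ} (hδ : 0 < δ) (h1 : (49 / 50 : ℝ) ^ δ ≤ ρ) (h2 : 79 / 80 * (8 : ℝ) ^ δ ≤ ρ) :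
    ∫⁻ x, potential δ v S (c' x) ∂(roundMeasure V b) ≤
      ENNReal.ofReal ρ * potential δ v (N v) c := by
  classical
  obtain ⟨q, hq⟩ : ∃ q, q = (max (∑ u ∈ S, nextWeight N c b u) (1 / 8)) ^ 2 /
    nextWeight N c b v := ⟨_, rfl⟩
  have hweight : ∀ x, ∀ u ∈ insert v (S : Set V), (c' x u).weight = nextWeight N c b u := by
    intro x u hu
    rw [Core.weight, (hc' x u hu).2, round_lvl, nextWeight]
  have hpsi : ∀ x, psi v S (c' x) = q := by
    intro x
    rw [hq, psi, hweight x v (Or.inl rfl), nbrWeight,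
      Finset.sum_congr rfl fun u hu => hweight x u (Or.inr hu)]
  set J : Set (V → Fin b → Bool) := {x | ∃ u ∈ insert v (S : Set V), Joins N c x u} with hJ
  have hle : ∀ x, potential δ v S (c' x) ≤ Jᶜ.indicator (fun _ => ENNReal.ofReal (q ^ δ)) x := by
    intro x
    rw [potential]
    split_ifs with hU
    · rw [Set.indicator_of_mem, hpsi]
      rintro ⟨u, hu, hj⟩
      have hM : (c' x u).inM := ((hc' x u hu).1).2 (round_inM_iff ..|>.2 (Or.inr hj))
      rcases hu with rfl | hu
      · exact hU.1 hM
      · exact hU.2.2 u hu hM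
    · exact zero_le
  have hq0 : 0 ≤ q := by rw [hq]; unfold nextWeight; positivity
  have hψ := psi_pos v (N v) c
  have hmain : (roundMeasure V b).real Jᶜ * q ^ δ ≤ ρ * psi v (N v) c ^ δ := by
    have hcompl : (roundMeasure V b).real Jᶜ = 1 - (roundMeasure V b).real J :=
      probReal_compl_eq_one_sub (Set.toFinite _).measurableSet
    rcases potential_drift hc hirr hb hv hS q hq with h | ⟨h, hJp⟩
    · calc (roundMeasure V b).real Jᶜ * q ^ δ ≤ 1 * (49 / 50 * psi v (N v) c) ^ δ := by
            gcongr; exact measureReal_le_one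
        _ = (49 / 50) ^ δ * psi v (N v) c ^ δ := by
            rw [one_mul, Real.mul_rpow (by norm_num) hψ.le]
        _ ≤ _ := by gcongr
    · calc (roundMeasure V b).real Jᶜ * q ^ δ ≤ 79 / 80 * (8 * psi v (N v) c) ^ δ := by
            gcongr; rw [hcompl]; linarith
        _ = 79 / 80 * 8 ^ δ * psi v (N v) c ^ δ := by
            rw [Real.mul_rpow (by norm_num) hψ.le, mul_assoc]
        _ ≤ _ := by gcongr
  calc ∫⁻ x, potential δ v S (c' x) ∂(roundMeasure V b)
      ≤ ∫⁻ x, Jᶜ.indicator (fun _ => ENNReal.ofReal (q ^ δ)) x ∂(roundMeasure V b) :=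
        lintegral_mono hle
    _ ≤ ENNReal.ofReal (q ^ δ) * (roundMeasure V b) Jᶜ := lintegral_indicator_const_le _ _
    _ = ENNReal.ofReal ((roundMeasure V b).real Jᶜ * q ^ δ) := by
        rw [ENNReal.ofReal_mul measureReal_nonneg, ofReal_measureReal, mul_comm]
    _ ≤ ENNReal.ofReal (ρ * psi v (N v) c ^ δ) := ENNReal.ofReal_le_ofReal hmain
    _ = _ := by
        rw [potential, if_pos hv, ENNReal.ofReal_mul]
        exact le_trans (by positivity) h1

end Potential

/-! ### Whole executions -/

section TapeIntegral
variable {V : Type} [Fintype V] {b : ℕ}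

instance : IsProbabilityMeasure (tapeMeasure V b) := by unfold tapeMeasure; infer_instance

lemma tapeMeasure_eq : tapeMeasure V b = Measure.infinitePi fun _ : ℕ => roundMeasure V b := rfl

/-- Resampling the bits of round `s` does not change the distribution of the tape. -/
lemma map_update_tapeMeasure (s : ℕ) :
    ((tapeMeasure V b).prod (roundMeasure V b)).map (fun p => Function.update p.1 s p.2) =
      tapeMeasure V b := by
  rw [tapeMeasure_eq]
  refine Measure.eq_infinitePi _ fun S t ht => ?_
  rw [Measure.map_apply measurable_update' (MeasurableSet.pi S.countable_toSet fun i _ => ht i)]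
  by_cases hs : s ∈ S
  · have : (fun p : Tape V b × (V → Fin b → Bool) => Function.update p.1 s p.2) ⁻¹'
      (↑S : Set ℕ).pi t =
        ((↑(S.erase s) : Set ℕ).pi t) ×ˢ t s := by
      ext p
      simp only [Set.mem_preimage, Set.mem_pi, Set.mem_prod, Finset.mem_coe, Finset.mem_erase]
      constructor
      · intro h
        refine ⟨fun i hi => ?_, ?_⟩
        · have := h i hi.2
          rwa [Function.update_of_ne hi.1] at this
        · have := h s hs
          rwa [Function.update_self] at this
      · rintro ⟨h1, h2⟩ i hi
        by_cases his : i = s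
        · subst his; rwa [Function.update_self]
        · rw [Function.update_of_ne his]; exact h1 i ⟨his, hi⟩
    rw [this, Measure.prod_prod, Measure.infinitePi_pi _ fun i _ => ht i, mul_comm,
      Finset.mul_prod_erase S (fun i => roundMeasure V b (t i)) hs]
  · have : (fun p : Tape V b × (V → Fin b → Bool) => Function.update p.1 s p.2) ⁻¹'
      (↑S : Set ℕ).pi t =
        ((↑S : Set ℕ).pi t) ×ˢ Set.univ := by
      ext p
      simp only [Set.mem_preimage, Set.mem_pi, Set.mem_prod, Finset.mem_coe, Set.mem_univ, and_true]
      refine forall₂_congr fun i hi => ?_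
      have his : i ≠ s := fun h => hs (h ▸ hi)
      rw [Function.update_of_ne his]
    rw [this, Measure.prod_prod, Measure.infinitePi_pi _ fun i _ => ht i, measure_univ, mul_one]

/-- `f` depends only on the bits of the rounds before `s`. -/
def Before {β : Type*} (s : ℕ) (f : Tape V b → β) : Prop :=
  ∀ ω ω', (∀ i < s, ω i = ω' i) → f ω = f ω'

lemma Before.measurable {s : ℕ} {f : Tape V b → ENNReal} (hf : Before s f) : Measurable f := by
  let e : (Finset.range s → V → Fin b → Bool) → Tape V b := fun y i =>
    if h : i ∈ Finset.range s then y ⟨i, h⟩ else fun _ _ => false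
  have : f = (fun y => f (e y)) ∘ (Finset.range s).restrict := by
    ext ω
    refine hf _ _ fun i hi => ?_
    simp only [e, dif_pos (Finset.mem_range.2 hi), Finset.restrict]
  rw [this]
  exact Measurable.of_discrete.comp (Finset.measurable_restrict _)

lemma lintegral_update {s s' : ℕ} {f : Tape V b → ENNReal} (hf : Before s' f) :
    ∫⁻ ω, ∫⁻ x, f (Function.update ω s x) ∂(roundMeasure V b) ∂(tapeMeasure V b) =
      ∫⁻ ω, f ω ∂(tapeMeasure V b) := by
  conv_rhs => rw [← map_update_tapeMeasure s]
  rw [lintegral_map hf.measurable measurable_update', lintegral_prod]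
  exact (hf.measurable.comp measurable_update').aemeasurable

lemma lintegral_le_of_contraction {a : ℕ} {Φ : ℕ → Tape V b → ENNReal} {κ : ENNReal}
    (hΦ : ∀ k, Before (a + k) (Φ k))
    (hstep : ∀ k ω, ∫⁻ x, Φ (k + 1) (Function.update ω (a + k) x) ∂(roundMeasure V b) ≤ κ * Φ k ω)
    (m : ℕ) : ∫⁻ ω, Φ m ω ∂(tapeMeasure V b) ≤ κ ^ m * ∫⁻ ω, Φ 0 ω ∂(tapeMeasure V b) := by
  induction m with
  | zero => simp
  | succ m ih =>
    calc ∫⁻ ω, Φ (m + 1) ω ∂(tapeMeasure V b)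
        = ∫⁻ ω, ∫⁻ x, Φ (m + 1) (Function.update ω (a + m) x) ∂(roundMeasure V b)
            ∂(tapeMeasure V b) := (lintegral_update (hΦ (m + 1))).symm
      _ ≤ ∫⁻ ω, κ * Φ m ω ∂(tapeMeasure V b) := lintegral_mono fun ω => hstep m ω
      _ = κ * ∫⁻ ω, Φ m ω ∂(tapeMeasure V b) := lintegral_const_mul _ (hΦ m).measurable
      _ ≤ κ * (κ ^ m * ∫⁻ ω, Φ 0 ω ∂(tapeMeasure V b)) := by gcongr
      _ = _ := by ring

omit [Fintype V] in
lemma le_psi {v : V} {S : Finset V} {c : V → Core} (hc : ∀ u, (c u).lvl ∈ Set.Icc 3 b) :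
    1 / 8 ≤ psi v S c := by
  have h1 : (c v).weight ≤ (1 / 2) ^ 3 :=
    pow_le_pow_of_le_one (by norm_num) (by norm_num) (hc v).1
  rw [psi, le_div_iff₀ (weight_pos _)]
  have h2 : (1 / 8 : ℝ) ^ 2 ≤ (max (nbrWeight S c) (1 / 8)) ^ 2 := by
    gcongr; exact le_max_right _ _
  norm_num at h1 h2; linarith

lemma psi_le {n : ℕ} (hn : 1 ≤ n) (hV : Fintype.card V ≤ n) {v : V} {S : Finset V} {c : V → Core}
    (hc : ∀ u, (c u).lvl ∈ Set.Icc 3 b) : psi v S c ≤ n ^ 2 * 2 ^ b := by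
  have hn' : (1 : ℝ) ≤ n := by exact_mod_cast hn
  have h1 : (1 / 2 : ℝ) ^ b ≤ (c v).weight :=
    pow_le_pow_of_le_one (by norm_num) (by norm_num) (hc v).2
  have h2 : nbrWeight S c ≤ n := by
    calc nbrWeight S c ≤ ∑ _u ∈ S, (1 : ℝ) :=
          Finset.sum_le_sum fun u _ => pow_le_one₀ (by norm_num) (by norm_num)
      _ = S.card := by simp
      _ ≤ n := by exact_mod_cast (Finset.card_le_univ S).trans hV
  have h3 : max (nbrWeight S c) (1 / 8) ≤ n := max_le h2 (by linarith)
  have h0 : 0 ≤ max (nbrWeight S c) (1 / 8) := le_max_of_le_right (by norm_num)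
  calc psi v S c ≤ n ^ 2 / (1 / 2) ^ b := by unfold psi; gcongr
    _ = n ^ 2 * 2 ^ b := by rw [one_div_pow, div_div_eq_mul_div, div_one]

/-- A family of statuses and neighborhoods, the `k`-th ones at the beginning of round `a + k`, which
evolves around `v` as prescribed by `round` as long as the condition `alive` holds. The field
`before_N` says that the neighborhoods of a round do not depend on the bits of the previous round;
it is the one property for which the adversary has to be `2`-oblivious. -/
structure IsProcess (v : V) (a : ℕ) (N : ℕ → Tape V b → V → Finset V)
    (c : ℕ → Tape V b → V → Core) (alive : ℕ → Tape V b → Prop) : Prop where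
  before_N : ∀ k, Before (a + k - 1) (N k)
  before_c : ∀ k, Before (a + k) (c k)
  before_alive : ∀ k, Before (a + k) (alive k)
  lvl_mem : ∀ k ω u, (c k ω u).lvl ∈ Set.Icc 3 b
  irrefl : ∀ k ω u, u ∉ N k ω u
  anti : ∀ k ω, alive (k + 1) ω → N (k + 1) ω v ⊆ N k ω v
  undecided : ∀ k ω, alive (k + 1) ω → Undecided v (N (k + 1) ω v) (c (k + 1) ω) →
    alive k ω ∧ Undecided v (N k ω v) (c k ω)
  round_eq : ∀ k ω, alive (k + 1) ω → ∀ u ∈ insert v (N (k + 1) ω v : Set V),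
    ((c (k + 1) ω u).inM ↔ (round (N k ω) (c k ω) (ω (a + k)) u).inM) ∧
      (c (k + 1) ω u).lvl = (round (N k ω) (c k ω) (ω (a + k)) u).lvl

/-- The probability that `v` is still undecided after `m` rounds decays exponentially in `m`. -/
theorem IsProcess.measure_undecided_le {v : V} {a : ℕ} {N : ℕ → Tape V b → V → Finset V}
    {c : ℕ → Tape V b → V → Core} {alive : ℕ → Tape V b → Prop} (h : IsProcess v a N c alive)
    {n : ℕ} (hn : 1 ≤ n) (hV : Fintype.card V ≤ n) (hb : 128 * n ≤ 2 ^ b)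
    {δ ρ : ℝ} (hδ : 0 < δ) (h1 : (49 / 50 : ℝ) ^ δ ≤ ρ) (h2 : 79 / 80 * (8 : ℝ) ^ δ ≤ ρ) (m : ℕ) :
    (tapeMeasure V b).real {ω | alive m ω ∧ Undecided v (N m ω v) (c m ω)} ≤
      ρ ^ m * (8 * (n ^ 2 * 2 ^ b)) ^ δ := by
  classical
  have hρ : 0 < ρ := lt_of_lt_of_le (by positivity) h1
  let Φ : ℕ → Tape V b → ENNReal := fun k ω =>
    if alive k ω then potential δ v (N k ω v) (c k ω) else 0
  have hΦ : ∀ k, Before (a + k) (Φ k) := by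
    intro k ω ω' hω
    have hN := h.before_N k ω ω' fun i hi => hω i (by omega)
    simp only [Φ, hN, h.before_c k ω ω' hω, h.before_alive k ω ω' hω]
  have hstep : ∀ k ω, ∫⁻ x, Φ (k + 1) (Function.update ω (a + k) x) ∂(roundMeasure V b) ≤
      ENNReal.ofReal ρ * Φ k ω := by
    intro k ω
    have hupd : ∀ x, ∀ i < a + k, Function.update ω (a + k) x i = ω i := fun x i hi =>
      Function.update_of_ne hi.ne _ _
    have hN : ∀ x, N k (Function.update ω (a + k) x) = N k ω := fun x =>
      h.before_N k _ _ fun i hi => hupd x i (by omega)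
    have hN' : ∀ x, N (k + 1) (Function.update ω (a + k) x) = N (k + 1) ω := fun x =>
      h.before_N (k + 1) _ _ fun i hi => hupd x i (by omega)
    have hc : ∀ x, c k (Function.update ω (a + k) x) = c k ω := fun x =>
      h.before_c k _ _ (hupd x)
    have halive : ∀ x, alive k (Function.update ω (a + k) x) = alive k ω := fun x =>
      h.before_alive k _ _ (hupd x)
    by_cases hU : alive k ω ∧ Undecided v (N k ω v) (c k ω)
    swap
    · refine le_of_eq_of_le (lintegral_eq_zero_of_ae_eq_zero (ae_of_all _ fun x => ?_)) zero_le
      simp only [Φ, potential, Pi.zero_apply]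
      split_ifs with hA hU'
      · have := h.undecided k _ hA hU'
        rw [hN, hc, halive] at this
        exact absurd this hU
      · rfl
      · rfl
    -- `alive (k + 1)` may depend on the bits of round `a + k`; a single tape on which it holds
    -- yields `hsub`, as the neighborhoods do not depend on these bits
    by_cases hA : ∃ x, alive (k + 1) (Function.update ω (a + k) x)
    swap
    · push Not at hA
      simp [Φ, hA]
    obtain ⟨x₀, hx₀⟩ := hA
    have hsub := h.anti k _ hx₀
    rw [hN, hN'] at hsub
    have hΦk : Φ k ω = potential δ v (N k ω v) (c k ω) := if_pos hU.1
    rw [hΦk]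
    -- outside of the event that the process is still alive, any continuation will do
    let c' : (V → Fin b → Bool) → V → Core := fun x =>
      if alive (k + 1) (Function.update ω (a + k) x) then c (k + 1) (Function.update ω (a + k) x)
      else round (N k ω) (c k ω) x
    refine le_trans (lintegral_mono fun x => ?_) (lintegral_potential_le (h.lvl_mem k ω)
      (h.irrefl k ω) (le_trans (by omega) hb) hU.2 hsub (c' := c') (fun x u hu => ?_) hδ h1 h2)
    · simp only [Φ, c']
      split_ifs with hA
      · rw [hN']
      · exact zero_le
    · simp only [c']
      split_ifs with hA
      · have := h.round_eq k _ hA u (by rwa [hN'])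
        rwa [hN, hc, Function.update_self] at this
      · exact ⟨Iff.rfl, rfl⟩
  have hint := lintegral_le_of_contraction hΦ hstep m
  have h0 : ∫⁻ ω, Φ 0 ω ∂(tapeMeasure V b) ≤ ENNReal.ofReal ((n ^ 2 * 2 ^ b : ℝ) ^ δ) := by
    refine (lintegral_mono (g := fun _ => ENNReal.ofReal ((n ^ 2 * 2 ^ b : ℝ) ^ δ))
      fun ω => ?_).trans (by simp)
    simp only [Φ, potential]
    split_ifs
    · exact ENNReal.ofReal_le_ofReal (Real.rpow_le_rpow (psi_pos ..).le
        (psi_le hn hV (h.lvl_mem 0 ω)) hδ.le)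
    · exact zero_le
    · exact zero_le
  have hmark : ENNReal.ofReal ((1 / 8) ^ δ) *
      tapeMeasure V b {ω | alive m ω ∧ Undecided v (N m ω v) (c m ω)} ≤
      ∫⁻ ω, Φ m ω ∂(tapeMeasure V b) := by
    refine le_trans ?_ (mul_meas_ge_le_lintegral₀ (hΦ m).measurable.aemeasurable
      (ENNReal.ofReal ((1 / 8) ^ δ)))
    gcongr with ω
    rintro ⟨hA, hU⟩
    simp only [Φ, if_pos hA, potential, if_pos hU]
    exact ENNReal.ofReal_le_ofReal (Real.rpow_le_rpow (by norm_num) (le_psi (h.lvl_mem m ω)) hδ.le)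
  have hall := hmark.trans (hint.trans (mul_le_mul_right h0 _))
  rw [← ENNReal.ofReal_pow hρ.le, ← ENNReal.ofReal_mul (by positivity),
    ← ofReal_measureReal, ← ENNReal.ofReal_mul (by positivity),
    ENNReal.ofReal_le_ofReal_iff (by positivity)] at hall
  have h8 : (8 : ℝ) ^ δ * (1 / 8) ^ δ = 1 := by
    rw [← Real.mul_rpow (by norm_num) (by norm_num)]; norm_num
  rw [Real.mul_rpow (by norm_num) (by positivity)]
  calc _ = (8 : ℝ) ^ δ * ((1 / 8) ^ δ *
        (tapeMeasure V b).real {ω | alive m ω ∧ Undecided v (N m ω v) (c m ω)}) := by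
        rw [← mul_assoc, h8, one_mul]
    _ ≤ (8 : ℝ) ^ δ * (ρ ^ m * (n ^ 2 * 2 ^ b : ℝ) ^ δ) := by gcongr
    _ = _ := by ring

end TapeIntegral

section Processes
variable {V : Type} [Fintype V] {ident : V → ℕ} {b T : ℕ}

lemma commonNbrs_congr {G G' : ℕ → Net V} {t s : ℕ} (hG : ∀ l ≤ s, t ≤ l → G l = G' l) :
    commonNbrs G t s = commonNbrs G' t s := by
  ext u w
  simp only [mem_commonNbrs]
  exact forall₂_congr fun l hl => by rw [hG l hl.2 hl.1]

lemma run_congr (A : Alg) {G G' : ℕ → Net V} {ω ω' : Tape V A.bits} {s : ℕ}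
    (hG : ∀ l < s, G l = G' l) (hω : ∀ l < s, ω l = ω' l) :
    A.run ident G ω s = A.run ident G' ω' s := by
  induction s with
  | zero => rfl
  | succ s ih =>
    have ih := ih (fun l hl => hG l (by omega)) (fun l hl => hω l (by omega))
    have hs := hG s (Nat.lt_succ_self s)
    have hN : commonNbrs G s s = commonNbrs G' s s :=
      commonNbrs_congr fun l hl hl' => by rwa [le_antisymm hl hl']
    ext1 u
    by_cases hu : u ∈ (G s).verts
    · rw [run_succ_of_mem A hu, run_succ_of_mem A (hs ▸ hu), ih, hω s (Nat.lt_succ_self s), hN]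
    · rw [run_succ_of_notMem A hu, run_succ_of_notMem A (hs ▸ hu), ih]

omit [Fintype V] in
lemma StaticOn.congr {G G' : ℕ → Net V} {a r r₂ : ℕ} {v : V} (hr : r ≤ r₂)
    (hG : ∀ l ≤ r₂, G l = G' l) (h : StaticOn G a v r r₂) : StaticOn G' a v r r₂ := by
  refine ⟨hG r hr ▸ h.1, fun l hl l' hl' => ?_⟩
  rw [← hG l hl.2, ← hG l' hl'.2]
  exact h.2 l hl l' hl'

omit [Fintype V] in
lemma Adversary.graph_congr (adv : Adversary V b 2) {s : ℕ} {ω ω' : Tape V b}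
    (h : ∀ i < s, ω i = ω' i) : ∀ l ≤ s + 1, adv.graph ω l = adv.graph ω' l :=
  fun l hl => adv.oblivious ω ω' l fun i hi => h i (by omega)

/-- The instance of round `t` at a node `v` that takes part in it. -/
lemma isProcess_inst (hi : Function.Injective ident) (hb : 3 ≤ b) (adv : Adversary V b 2) (t : ℕ)
    (v : V) : IsProcess v (t + 1) (fun k ω => commonNbrs (adv.graph ω) t (t + 1 + k))
      (fun k ω => instCore ident b T (adv.graph ω) ω t k)
      (fun _ ω => v ∈ (adv.graph ω t).verts) where
  before_N k ω ω' h := commonNbrs_congr fun l hl _ => adv.graph_congr h l (by omega)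
  before_c k ω ω' h := by
    ext1 u
    exact congrArg (fun st => (st u : NodeState).inst k) (run_congr (misAlg b T)
      (fun l hl => adv.graph_congr h l (by omega)) h)
  before_alive k ω ω' h := by
    beta_reduce
    rw [adv.graph_congr h t (by omega)]
  lvl_mem k ω u := (state_lvl_mem hb _ u).2 k
  irrefl k ω u := not_mem_commonNbrs_self (by omega) u
  anti k ω _ := commonNbrs_anti (by omega) v
  undecided k ω hv hU := by
    refine ⟨hv, ?_⟩
    by_contra hcon
    rcases decided_instCore_succ hi (adv.verts_mono ω) hv hcon with h | h
    · exact hU.1 h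
    · exact hU.2.1 h
  round_eq k ω hv u hu := by
    have hut : u ∈ (adv.graph ω t).verts := by
      rcases hu with rfl | hu
      · exact hv
      · exact mem_verts_of_mem_commonNbrs (by omega) hu
    rw [instCore_succ hi (adv.verts_mono ω) hut]
    exact ⟨Iff.rfl, rfl⟩

/-- The base process at `v`, from round `r + 1` on, as long as the `2`-neighborhood of `v` has been
static since round `r`. In round `r` itself there may still be adjacent members. -/
lemma isProcess_base (hb : 3 ≤ b) (adv : Adversary V b 2) (r : ℕ) (v : V) :
    IsProcess v (r + 1)
      (fun k ω => commonNbrs (adv.graph ω) (r + 1 + k) (r + 1 + k))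
      (fun k ω => baseCore ident b T (adv.graph ω) ω (r + 1 + k))
      (fun k ω => StaticOn (adv.graph ω) 2 v r (r + 1 + k)) where
  before_N k ω ω' h := commonNbrs_congr fun l hl _ => adv.graph_congr h l (by omega)
  before_c k ω ω' h := by
    ext1 u
    exact congrArg (fun st => (st u : NodeState).base) (run_congr (misAlg b T)
      (fun l hl => adv.graph_congr h l (by omega)) h)
  before_alive k ω ω' h := by
    have hG : ∀ l ≤ r + 1 + k, adv.graph ω l = adv.graph ω' l :=
      fun l hl => adv.graph_congr h l (by omega)
    exact propext ⟨StaticOn.congr (by omega) hG,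
      StaticOn.congr (by omega) fun l hl => (hG l hl).symm⟩
  lvl_mem k ω u := (state_lvl_mem hb _ u).1
  irrefl k ω u := not_mem_commonNbrs_self le_rfl u
  anti k ω h := (h.commonNbrs_eq ⟨by omega, le_rfl⟩ ⟨by omega, by omega⟩).subset
  undecided k ω h hU := ⟨h.mono (by omega),
    h.undecided_of_undecided_succ (adv.verts_mono ω) (by omega) (by omega) hU⟩
  round_eq k ω h u hu := by
    have hv : v ∈ (adv.graph ω (r + 1 + k)).verts :=
      adv.verts_mono ω (show r ≤ r + 1 + k by omega) h.1
    have hut : u ∈ (adv.graph ω (r + 1 + k)).verts := by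
      rcases hu with rfl | hu
      · exact hv
      · rw [h.commonNbrs_eq (l' := r + 1 + k) ⟨by omega, le_rfl⟩ ⟨by omega, by omega⟩] at hu
        exact mem_verts_of_mem_commonNbrs le_rfl hu
    have := baseCore_succ (ident := ident) (b := b) (T := T) (ω := ω) hut
    change ((baseCore ident b T (adv.graph ω) ω (r + 1 + k + 1) u).inM ↔ _) ∧
      (baseCore ident b T (adv.graph ω) ω (r + 1 + k + 1) u).lvl = _
    rw [this]
    exact ⟨Iff.rfl, rfl⟩

theorem goodExecution_of_decided (hi : Function.Injective ident) (adv : Adversary V b 2)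
    {m L : ℕ} (ω : Tape V b)
    (h1 : ∀ t ≤ L, ∀ v, ¬ (v ∈ (adv.graph ω t).verts ∧ Undecided v
      (commonNbrs (adv.graph ω) t (t + 1 + m) v)
      (instCore ident b (m + 2) (adv.graph ω) ω t m)))
    (h2 : ∀ r ≤ L, ∀ v, ¬ (StaticOn (adv.graph ω) 2 v r (r + 1 + (m + 1)) ∧ Undecided v
      (commonNbrs (adv.graph ω) (r + 1 + (m + 1)) (r + 1 + (m + 1)) v)
      (baseCore ident b (m + 2) (adv.graph ω) ω (r + 1 + (m + 1))))) :
    GoodExecution (adv.graph ω) ((misAlg b (m + 2)).output ident (adv.graph ω) ω) (m + 2) L := by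
  have hG := adv.verts_mono ω
  refine ⟨fun r hr => isDynamicMIS_output hi hG (adv.verts_zero ω) (by omega) fun v hv hU =>
    h1 _ (by omega) v ⟨hv, hU⟩, fun v r r₂ hr₂ hst l hl l' hl' => ?_⟩
  have hr : r + (m + 2) = r + 1 + (m + 1) := by ring
  have := hl.1
  have := hl.2
  refine hst.output_eq_output hG hi (by omega) (fun hU => h2 r (by omega) v ⟨?_, ?_⟩) hl hl'
  · exact hst.mono (by omega)
  · rwa [hr] at hU

theorem measureReal_goodExecution_ge (hi : Function.Injective ident) (hb : 3 ≤ b)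
    (adv : Adversary V b 2) {n : ℕ} (hn : 1 ≤ n) (hV : Fintype.card V ≤ n) (hbn : 128 * n ≤ 2 ^ b)
    {δ ρ : ℝ} (hδ : 0 < δ) (h1 : (49 / 50 : ℝ) ^ δ ≤ ρ) (h2 : 79 / 80 * (8 : ℝ) ^ δ ≤ ρ)
    (hρ : ρ ≤ 1) (m L : ℕ) :
    1 - 2 * n * (L + 1) * (ρ ^ m * (8 * (n ^ 2 * 2 ^ b)) ^ δ) ≤
      (tapeMeasure V b).real {ω | GoodExecution (adv.graph ω)
        ((misAlg b (m + 2)).output ident (adv.graph ω) ω) (m + 2) L} := by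
  have hρ0 : 0 < ρ := lt_of_lt_of_le (by positivity) h1
  set good : Set (Tape V b) := {ω | GoodExecution (adv.graph ω)
        ((misAlg b (m + 2)).output ident (adv.graph ω) ω) (m + 2) L}
  set B := ρ ^ m * (8 * (n ^ 2 * 2 ^ b) : ℝ) ^ δ with hB
  let E : ℕ × V → Set (Tape V b) := fun p => {ω | p.2 ∈ (adv.graph ω p.1).verts ∧ Undecided p.2
      (commonNbrs (adv.graph ω) p.1 (p.1 + 1 + m) p.2)
      (instCore ident b (m + 2) (adv.graph ω) ω p.1 m)}
  let F : ℕ × V → Set (Tape V b) := fun p =>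
    {ω | StaticOn (adv.graph ω) 2 p.2 p.1 (p.1 + 1 + (m + 1)) ∧ Undecided p.2
      (commonNbrs (adv.graph ω) (p.1 + 1 + (m + 1)) (p.1 + 1 + (m + 1)) p.2)
      (baseCore ident b (m + 2) (adv.graph ω) ω (p.1 + 1 + (m + 1)))}
  let I : Finset (ℕ × V) := Finset.range (L + 1) ×ˢ Finset.univ
  have hE : ∀ p, (tapeMeasure V b).real (E p) ≤ B := fun p =>
    (isProcess_inst (T := m + 2) hi hb adv p.1 p.2).measure_undecided_le hn hV hbn hδ h1 h2 m
  have hF : ∀ p, (tapeMeasure V b).real (F p) ≤ B := fun p =>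
    ((isProcess_base (ident := ident) (T := m + 2) hb adv p.1 p.2).measure_undecided_le hn hV hbn
      hδ h1 h2 (m + 1)).trans (by
        rw [hB]
        exact mul_le_mul_of_nonneg_right (pow_le_pow_of_le_one hρ0.le hρ (Nat.le_succ m))
          (by positivity))
  have hcover : Set.univ ⊆ good ∪ ((⋃ p ∈ I, E p) ∪ ⋃ p ∈ I, F p) := by
    intro ω _
    by_contra hcon
    simp only [Set.mem_union, not_or, Set.mem_iUnion, not_exists] at hcon
    have hI : ∀ t ≤ L, ∀ v, (t, v) ∈ I := fun t ht v =>
      Finset.mem_product.2 ⟨Finset.mem_range.2 (by omega), Finset.mem_univ v⟩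
    exact hcon.1 (goodExecution_of_decided hi adv ω (fun t ht v => hcon.2.1 (t, v) (hI t ht v))
      fun r hr v => hcon.2.2 (r, v) (hI r hr v))
  have hunion : ∀ D : ℕ × V → Set (Tape V b), (∀ p, (tapeMeasure V b).real (D p) ≤ B) →
      (tapeMeasure V b).real (⋃ p ∈ I, D p) ≤ (L + 1) * n * B := by
    intro D hD
    refine (measureReal_biUnion_finset_le I D).trans ((Finset.sum_le_sum fun p _ => hD p).trans ?_)
    rw [Finset.sum_const, nsmul_eq_mul, Finset.card_product, Finset.card_range, Finset.card_univ]
    push_cast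
    gcongr
  have := (measureReal_mono (μ := tapeMeasure V b) hcover).trans ((measureReal_union_le _ _).trans
    (add_le_add le_rfl (measureReal_union_le _ _)))
  rw [probReal_univ] at this
  have hE' := hunion E hE
  have hF' := hunion F hF
  linarith

end Processes

/-! ### Choice of the parameters -/

lemma exists_contraction_constants : ∃ δ ρ : ℝ, 0 < δ ∧ δ ≤ 1 ∧ ρ < 1 ∧
    (49 / 50 : ℝ) ^ δ ≤ ρ ∧ 79 / 80 * (8 : ℝ) ^ δ ≤ ρ := by
  refine ⟨1 / 1000, _, by norm_num, by norm_num, ?_, le_max_left _ _, le_max_right _ _⟩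
  refine max_lt (Real.rpow_lt_one (by norm_num) (by norm_num) (by norm_num)) ?_
  -- Bernoulli's inequality shows that `8 ^ (1 / 1000)` is below `101 / 100 < 80 / 79`
  have h1 : (8 : ℝ) ≤ (1 + 1 / 100) ^ (1000 : ℕ) :=
    le_trans (by norm_num) (one_add_mul_le_pow (by norm_num : (-2 : ℝ) ≤ 1 / 100) 1000)
  have h2 : (8 : ℝ) ^ (1 / 1000 : ℝ) ≤ 1 + 1 / 100 := by
    calc (8 : ℝ) ^ (1 / 1000 : ℝ) ≤ ((1 + 1 / 100) ^ (1000 : ℕ)) ^ (1 / 1000 : ℝ) := by gcongr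
      _ = 1 + 1 / 100 := by
        rw [← Real.rpow_natCast, ← Real.rpow_mul (by norm_num)]; norm_num
  linarith

lemma exists_eval_add_one_le_pow (L : Polynomial ℕ) :
    ∃ e : ℕ, ∀ n, 2 ≤ n → L.eval n + 1 ≤ n ^ e := by
  induction L using Polynomial.induction_on' with
  | add p q hp hq =>
    obtain ⟨e, he⟩ := hp
    obtain ⟨e', he'⟩ := hq
    refine ⟨max e e' + 1, fun n hn => ?_⟩
    have h1 := (he n hn).trans (Nat.pow_le_pow_right (by omega) (le_max_left e e'))
    have h2 := (he' n hn).trans (Nat.pow_le_pow_right (by omega) (le_max_right e e'))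
    rw [Polynomial.eval_add, pow_succ]
    have := Nat.mul_le_mul_left (n ^ max e e') hn
    omega
  | monomial k a =>
    refine ⟨a + 1 + k, fun n hn => ?_⟩
    rw [Polynomial.eval_monomial, pow_add]
    have h1 : a + 1 ≤ n ^ (a + 1) :=
      (Nat.lt_two_pow_self (n := a + 1)).le.trans (Nat.pow_le_pow_left hn _)
    have h2 : 1 ≤ n ^ k := Nat.one_le_pow _ _ (by omega)
    calc a * n ^ k + 1 ≤ (a + 1) * n ^ k := by rw [add_mul]; omega
      _ ≤ _ := Nat.mul_le_mul_right _ h1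

lemma isBigO_natLog (C D : ℕ) :
    (fun n : ℕ => ((C * (Nat.log 2 n + 1) + D : ℕ) : ℝ)) =O[atTop]
      fun n : ℕ => Real.log (n : ℝ) := by
  refine IsBigO.of_bound (4 * C + 2 * D) ?_
  filter_upwards [eventually_ge_atTop 2] with n hn
  have hn' : (2 : ℝ) ≤ n := by exact_mod_cast hn
  have h2 : 1 / 2 < Real.log 2 := by linarith [Real.log_two_gt_d9]
  have h3 : Real.log 2 ≤ Real.log n := Real.log_le_log (by norm_num) hn'
  have h4 : (Nat.log 2 n : ℝ) * Real.log 2 ≤ Real.log n := by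
    rw [← Real.log_pow]
    refine Real.log_le_log (by positivity) ?_
    exact_mod_cast Nat.pow_log_le_self 2 (by omega)
  have h5 : (Nat.log 2 n : ℝ) ≤ 2 * Real.log n := by
    have : (0 : ℝ) ≤ Nat.log 2 n := Nat.cast_nonneg _
    nlinarith
  rw [Real.norm_of_nonneg (Nat.cast_nonneg _), Real.norm_of_nonneg (by linarith)]
  push_cast
  have hC : (C : ℝ) * (Nat.log 2 n + 1) ≤ C * (4 * Real.log n) := by gcongr; linarith
  have hD : (D : ℝ) * 1 ≤ D * (2 * Real.log n) := by gcongr; linarith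
  linarith

/-- With `C * (log₂ n + 1)` rounds the union bound is at most `n ^ (-c)`: the factors in front of
`ρ ^ (C * (log₂ n + 1)) ≤ n ^ (-E)` are at most `n ^ (16 + e)`. -/
lemma failure_bound {n e E C : ℕ} {c δ ρ l : ℝ} (hn : 2 ≤ n) (hδ : 0 < δ) (hδ1 : δ ≤ 1)
    (hρ : 0 < ρ) (hl0 : 0 ≤ l) (hl : l + 1 ≤ n ^ e) (hE : 16 + e + c ≤ E)
    (hC : ρ ^ C ≤ (1 / 2) ^ E) :
    2 * n * (l + 1) * (ρ ^ (C * (Nat.log 2 n + 1)) *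
      (8 * (n ^ 2 * 2 ^ (Nat.log 2 n + 8))) ^ δ) ≤ 1 / (n : ℝ) ^ c := by
  have hn' : (2 : ℝ) ≤ n := by exact_mod_cast hn
  have hn0 : (0 : ℝ) < n := by linarith
  have h1 : (8 * (n ^ 2 * 2 ^ (Nat.log 2 n + 8)) : ℝ) ≤ n ^ 14 := by
    have ha : (2 : ℝ) ^ Nat.log 2 n ≤ n := by exact_mod_cast Nat.pow_log_le_self 2 (by omega)
    have hb : (2 : ℝ) ^ 11 ≤ n ^ 11 := by gcongr
    calc (8 * (n ^ 2 * 2 ^ (Nat.log 2 n + 8)) : ℝ) = 2 ^ 11 * (n ^ 2 * 2 ^ Nat.log 2 n) := by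
          rw [pow_add]; ring
      _ ≤ n ^ 11 * (n ^ 2 * n) := by gcongr
      _ = n ^ 14 := by ring
  have h2 : (8 * (n ^ 2 * 2 ^ (Nat.log 2 n + 8)) : ℝ) ^ δ ≤ n ^ 14 := by
    calc (8 * (n ^ 2 * 2 ^ (Nat.log 2 n + 8)) : ℝ) ^ δ ≤ ((n : ℝ) ^ 14) ^ δ := by gcongr
      _ ≤ ((n : ℝ) ^ 14) ^ (1 : ℝ) :=
        Real.rpow_le_rpow_of_exponent_le (one_le_pow₀ (by linarith)) hδ1
      _ = n ^ 14 := Real.rpow_one _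
  have h3 : ρ ^ (C * (Nat.log 2 n + 1)) ≤ 1 / (n : ℝ) ^ E := by
    have hlt : (n : ℝ) ≤ 2 ^ (Nat.log 2 n + 1) := by
      exact_mod_cast (Nat.lt_pow_succ_log_self (by norm_num : 1 < 2) n).le
    calc ρ ^ (C * (Nat.log 2 n + 1)) = (ρ ^ C) ^ (Nat.log 2 n + 1) := pow_mul _ _ _
      _ ≤ ((1 / 2) ^ E) ^ (Nat.log 2 n + 1) := by gcongr
      _ = 1 / (2 ^ (Nat.log 2 n + 1)) ^ E := by
        rw [← pow_mul, mul_comm, pow_mul, one_div_pow, one_div_pow]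
      _ ≤ _ := by gcongr
  calc 2 * n * (l + 1) * (ρ ^ (C * (Nat.log 2 n + 1)) *
      (8 * (n ^ 2 * 2 ^ (Nat.log 2 n + 8))) ^ δ)
      ≤ n * n * n ^ e * (1 / (n : ℝ) ^ E * n ^ 14) := by gcongr
    _ = (n : ℝ) ^ (16 + e) / n ^ E := by rw [pow_add]; ring
    _ ≤ 1 / (n : ℝ) ^ c := by
      rw [div_le_div_iff₀ (by positivity) (by positivity), one_mul, ← Real.rpow_natCast,
        ← Real.rpow_add hn0, ← Real.rpow_natCast]
      refine Real.rpow_le_rpow_of_exponent_le (by linarith) ?_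
      push_cast; linarith

end DynNet

theorem corollary3 (c : ℝ) (hc : 1 < c) (L : Polynomial ℕ) :
    ∃ T : ℕ → ℕ, (∀ n, 1 ≤ T n) ∧
      (fun n : ℕ => (T n : ℝ)) =O[atTop] (fun n : ℕ => Real.log (n : ℝ)) ∧
      ∃ A : ℕ → DynNet.Alg,
        ∀ n : ℕ, 1 ≤ n → ∀ (V : Type) [Fintype V], Fintype.card V ≤ n →
          ∀ ident : V → ℕ, Function.Injective ident →
            ∀ adv : DynNet.Adversary V (A n).bits 2,
              1 - 1 / (n : ℝ) ^ c ≤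
                (DynNet.tapeMeasure V (A n).bits).real
                  {ω | DynNet.GoodExecution (adv.graph ω)
                    ((A n).output ident (adv.graph ω) ω) (T n) (L.eval n)} := by
  obtain ⟨δ, ρ, hδ, hδ1, hρ1, h1, h2⟩ := DynNet.exists_contraction_constants
  have hρ : 0 < ρ := lt_of_lt_of_le (by positivity) h1
  obtain ⟨e, he⟩ := DynNet.exists_eval_add_one_le_pow L
  obtain ⟨E, hE⟩ := exists_nat_ge (16 + e + c)
  obtain ⟨C, hC⟩ := exists_pow_lt_of_lt_one (by positivity : (0 : ℝ) < (1 / 2) ^ E) hρ1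
  refine ⟨fun n => C * (Nat.log 2 n + 1) + 2, fun n => Nat.succ_pos _, DynNet.isBigO_natLog C 2,
    fun n => DynNet.misAlg (Nat.log 2 n + 8) (C * (Nat.log 2 n + 1) + 2), ?_⟩
  intro n hn V _ hV ident hi adv
  rcases hn.eq_or_lt with rfl | hn2
  · simp
  have hb : 128 * n ≤ 2 ^ (Nat.log 2 n + 8) := by
    have := Nat.lt_pow_succ_log_self (by norm_num : 1 < 2) n
    rw [Nat.succ_eq_add_one] at this
    calc 128 * n ≤ 128 * 2 ^ (Nat.log 2 n + 1) := by omega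
      _ = _ := by ring
  have hl : ((L.eval n : ℕ) : ℝ) + 1 ≤ n ^ e := by exact_mod_cast he n hn2
  have hmain := DynNet.measureReal_goodExecution_ge (b := Nat.log 2 n + 8) hi (by omega) adv hn hV
    hb hδ h1 h2 hρ1.le (C * (Nat.log 2 n + 1)) (L.eval n)
  have hfail := DynNet.failure_bound hn2 hδ hδ1 hρ (Nat.cast_nonneg _) hl hE hC.le
  exact le_trans (sub_le_sub_left hfail 1) hmain
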